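/- Let $m$ be a natural number, let $U,V$ be square integrable random vectors in $\mathbb{R}^m$ on a probability space $(\Omega,\mathcal{F},\mathbb{P})$, let $Y:=(U,V)$, and let $\nu$ be the law of $Y$ on $\mathbb{R}^{2m}$. Relations between random variables are understood almost surely; $X$ is called $Y$-measurable if $X=\varphi(Y)$ a.s. for a Borel function $\varphi$. Let $S$ be the standard form on $\mathbb{R}^{2m}=\mathbb{R}^m\times\mathbb{R}^m$, $$S((r,s),(u,v))=\langle s,u\rangle+\langle r,v\rangle .$$ *Equilibrium.* A $Y$-equilibrium is a pair $(R,f)$, where $R$ is a $Y$-measurable square integrable random vector in $\mathbb{R}^m$ and $f:\mathbb{R}^m\to\mathbb{R}^m$ is a Borel function (the pricing function), such that $f(R)=\mathbb{E}[V\mid R]$ and, almost surely, $Q:=R-U$ maximizes $q\mapsto\langle q,V-f(q+U)\rangle$ over $q\in\mathbb{R}^m$. The function $f$ is monotone if $\langle u-r,f(u)-f(r)\rangle\ge 0$ for all $u,r\in\mathbb{R}^m$. *Optimal maps.* Let $\mathcal{X}(Y)$ be the family of $Y$-measurable square integrable random vectors $X$ in $\mathbb{R}^{2m}$ with $\mathbb{E}[Y\mid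 X]=X$. An optimal map is an $X\in\mathcal{X}(Y)$ that maximizes $\frac12\mathbb{E}[S(X,Y)]$ over $\mathcal{X}(Y)$. *Optimal plans.* Let $\Gamma(\nu)$ be the family of Borel probability measures $\gamma(dx,dy)$ on $\mathbb{R}^{2m}\times\mathbb{R}^{2m}$ with finite second moment, with second marginal $\nu$, and such that $\gamma(y\mid x)=x$ (the conditional expectation under $\gamma$ of the coordinate $y$ given the coordinate $x$ equals $x$). An optimal plan is a $\gamma\in\Gamma(\nu)$ that maximizes $\frac12\int S(x,y)\,d\gamma$ over $\Gamma(\nu)$. *Dual-optimal sets.* A set $G\subset\mathbb{R}^{2m}$ is $S$-monotone if $S(x-y,x-y)\ge 0$ for all $x,y\in G$, and maximal $S$-monotone if moreover it is not a strict subset of an $S$-monotone set. Put $\psi_G(y):=\sup_{x\in G}\left(S(x,y)-\frac12 S(x,x)\right)\in(-\infty,\infty]$. A dual-optimal set is a maximal $S$-monotone set $G$ that minimizes $\int\psi_G\,d\nu$ over all maximal $S$-monotone sets. **Theorem.** The following conditions are equivalent: (a) There exists a $Y$-equilibrium $(R,f)$ with a monotone pricing function $f$. (b) There exist an optimal map $X$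 and a dual-optimal set $G$ such that the law of $(X,Y)$ is an optimal plan and the projection of $G$ on the first $m$ coordinates is the whole space: $$\{u\in\mathbb{R}^m:\ (u,v)\in G\text{ for some }v\in\mathbb{R}^m\}=\mathbb{R}^m. \qquad (*)$$ Under these conditions, for every dual-optimal set $G$ satisfying $(*)$ there exists a $Y$-equilibrium $(R,f)$ such that the graph $\{(r,f(r)):r\in\mathbb{R}^m\}$ is contained in $G$ and $(R,f(R))$ is an optimal map. -/

import Mathlib

open MeasureTheory
open scoped ENNReal RealInnerProductSpace

namespace BackwardTransport

noncomputable section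

/-- The scalar product `S(x, y) = ⟨x, S y⟩` of the `S`-space. -/
def sForm {ι : Type*} [Fintype ι] (S : Matrix ι ι ℝ) (x y : EuclideanSpace ℝ ι) : ℝ :=
  ∑ i, ∑ j, x i * S i j * y j

/-- `S`-monotone (`S`-positive) sets. -/
def IsSMonotone {ι : Type*} [Fintype ι] (S : Matrix ι ι ℝ)
    (G : Set (EuclideanSpace ℝ ι)) : Prop :=
  ∀ x ∈ G, ∀ y ∈ G, 0 ≤ sForm S (x - y) (x - y)

/-- Maximal `S`-monotone sets: not strictly contained in an `S`-monotone set. -/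
def IsMaxSMonotone {ι : Type*} [Fintype ι] (S : Matrix ι ι ℝ)
    (G : Set (EuclideanSpace ℝ ι)) : Prop :=
  Maximal (IsSMonotone S) G

/-- The Fitzpatrick function of `G` in the `S`-space, with values in the extended reals. -/
def fitzpatrick {ι : Type*} [Fintype ι] (S : Matrix ι ι ℝ)
    (G : Set (EuclideanSpace ℝ ι)) (y : EuclideanSpace ℝ ι) : EReal :=
  ⨆ x ∈ G, ((sForm S x y - 1 / 2 * sForm S x x : ℝ) : EReal)

/-- The integral of an extended-real function: integral of the positive part minus integral
of the negative part. (For Fitzpatrick functions of nonempty sets and measures with finite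
second moment the negative part has a finite integral.) -/
def extIntegral {α : Type*} [MeasurableSpace α] (ν : Measure α) (g : α → EReal) : EReal :=
  ((∫⁻ y, (g y).toENNReal ∂ν : ℝ≥0∞) : EReal) - ((∫⁻ y, (-g y).toENNReal ∂ν : ℝ≥0∞) : EReal)

/-- `G` is an optimal set for the dual problem: minimize `∫ ψ_G dν` over all maximal
`S`-monotone sets `G`. -/
def IsDualOptimal {ι : Type*} [Fintype ι] (S : Matrix ι ι ℝ)
    (ν : Measure (EuclideanSpace ℝ ι)) (G : Set (EuclideanSpace ℝ ι)) : Prop :=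
  IsMaxSMonotone S G ∧
    ∀ H, IsMaxSMonotone S H →
      extIntegral ν (fitzpatrick S G) ≤ extIntegral ν (fitzpatrick S H)

/-- `Γ(ν)`: probability measures `γ(dx, dy)` with finite second moment, second marginal `ν`
and the backward martingale property `γ(y | x) = x`. -/
structure IsBackwardPlan {ι : Type*} [Fintype ι] (ν : Measure (EuclideanSpace ℝ ι))
    (γ : Measure (EuclideanSpace ℝ ι × EuclideanSpace ℝ ι)) : Prop where
  isProb : IsProbabilityMeasure γ
  memLp_fst : MemLp Prod.fst 2 γ
  memLp_snd : MemLp Prod.snd 2 γ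
  marginal : γ.map Prod.snd = ν
  martingale : γ[Prod.snd | MeasurableSpace.comap Prod.fst inferInstance] =ᵐ[γ] Prod.fst

/-- `γ` is an optimal plan: it maximizes `½ ∫ S(x, y) dγ` over `Γ(ν)`. -/
def IsOptimalPlan {ι : Type*} [Fintype ι] (S : Matrix ι ι ℝ)
    (ν : Measure (EuclideanSpace ℝ ι))
    (γ : Measure (EuclideanSpace ℝ ι × EuclideanSpace ℝ ι)) : Prop :=
  IsBackwardPlan ν γ ∧
    ∀ γ', IsBackwardPlan ν γ' →
      1 / 2 * ∫ p, sForm S p.1 p.2 ∂γ' ≤ 1 / 2 * ∫ p, sForm S p.1 p.2 ∂γ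

/-- `X` is `Y`-measurable: `X = φ(Y)` almost surely for a Borel function `φ`. -/
def IsFunctionOf {Ω E F : Type*} [MeasurableSpace Ω] [MeasurableSpace E] [MeasurableSpace F]
    (P : Measure Ω) (X : Ω → E) (Y : Ω → F) : Prop :=
  ∃ φ : F → E, Measurable φ ∧ X =ᵐ[P] fun ω => φ (Y ω)

/-- The family `𝒳(Y)`: square integrable, `Y`-measurable `X` with `E[Y | X] = X`. -/
structure IsBackwardMap {Ω ι : Type*} [MeasurableSpace Ω] [Fintype ι] (P : Measure Ω)
    (Y X : Ω → EuclideanSpace ℝ ι) : Prop where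
  measurable : Measurable X
  memLp : MemLp X 2 P
  functionOf : IsFunctionOf P X Y
  martingale : P[Y | MeasurableSpace.comap X inferInstance] =ᵐ[P] X

/-- `X` is an optimal map: it maximizes `½ E[S(X, Y)]` over `𝒳(Y)`. -/
def IsOptimalMap {Ω ι : Type*} [MeasurableSpace Ω] [Fintype ι] (S : Matrix ι ι ℝ)
    (P : Measure Ω) (Y X : Ω → EuclideanSpace ℝ ι) : Prop :=
  IsBackwardMap P Y X ∧
    ∀ X', IsBackwardMap P Y X' →
      1 / 2 * ∫ ω, sForm S (X' ω) (Y ω) ∂P ≤ 1 / 2 * ∫ ω, sForm S (X ω) (Y ω) ∂P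

/-- The standard matrix on `ℝ^{2m}`, so that `S((r, s), (u, v)) = ⟨s, u⟩ + ⟨r, v⟩`. The
coordinates of `ℝ^{2m}` are indexed by `Fin m ⊕ Fin m`. -/
def stdMatrix (m : ℕ) : Matrix (Fin m ⊕ Fin m) (Fin m ⊕ Fin m) ℝ :=
  Matrix.fromBlocks 0 1 1 0

/-- The point `(u, v)` of `ℝ^{2m}`. -/
def pair {m : ℕ} (u v : EuclideanSpace ℝ (Fin m)) : EuclideanSpace ℝ (Fin m ⊕ Fin m) :=
  WithLp.toLp 2 (Sum.elim (fun i => u i) (fun i => v i))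

/-- The projection of a subset of `ℝ^{2m}` on the first `m` coordinates. -/
def projFst {m : ℕ} (G : Set (EuclideanSpace ℝ (Fin m ⊕ Fin m))) :
    Set (EuclideanSpace ℝ (Fin m)) :=
  {u | ∃ v, pair u v ∈ G}

/-- `(R, f)` is a `Y`-equilibrium for `Y = (U, V)`: the pricing rule is efficient, and the
insider's order `Q = R - U` maximizes the profit `q ↦ ⟨q, V - f(q + U)⟩`. -/
structure IsEquilibrium {Ω : Type*} [MeasurableSpace Ω] {m : ℕ} (P : Measure Ω)
    (U V R : Ω → EuclideanSpace ℝ (Fin m))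
    (f : EuclideanSpace ℝ (Fin m) → EuclideanSpace ℝ (Fin m)) : Prop where
  measurable_order : Measurable R
  memLp_order : MemLp R 2 P
  measurable_price : Measurable f
  functionOf : IsFunctionOf P R (fun ω => pair (U ω) (V ω))
  efficient : (fun ω => f (R ω)) =ᵐ[P] P[V | MeasurableSpace.comap R inferInstance]
  profit_max : ∀ᵐ ω ∂P, ∀ q : EuclideanSpace ℝ (Fin m),
    ⟪q, V ω - f (q + U ω)⟫ ≤ ⟪R ω - U ω, V ω - f ((R ω - U ω) + U ω)⟫

/-- Monotone functions from `ℝ^m` to `ℝ^m`. -/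
def IsMonotoneMap {m : ℕ} (f : EuclideanSpace ℝ (Fin m) → EuclideanSpace ℝ (Fin m)) : Prop :=
  ∀ u r, 0 ≤ ⟪u - r, f u - f r⟫

end

end BackwardTransport

open BackwardTransport

/-!
Write `q(x) = ½ S(x, x)` and `gain S x y = S(x, y) - q(x)`, so that the Fitzpatrick function is
`ψ_G(y) = sup_{x ∈ G} gain S x y`. The point of the proof is the identity
`gain S (r, s) (u, v) = ⟨r - u, v - s⟩ + ⟨u, v⟩` for the standard form: the insider who faces the
price `f` and knows `(U, V)` maximizes `gain S (r, f(r)) (U, V)` over `r`, so that the profit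
condition says that `(R, f(R))` attains the Fitzpatrick function of the graph of `f` at `Y`.

*Weak duality.* If `E[Y | X] = X` and `G` is maximal monotone, then, by Jensen's inequality,
`E ψ_G(Y) ≥ E ψ_G(X) ≥ E q(X) = ½ E S(X, Y)`. In the case of equality `X ∈ G` and `X` attains
`ψ_G(Y)` almost surely (`ae_mem_and_gain_le_gain`), and conversely a pair without a gap is optimal
on all sides (`optimal_of_no_gap`).

*From an equilibrium to a pair without a gap* (`IsEquilibrium.exists_no_gap`). A maximal monotone
extension `G` of the graph of `f` has the same Fitzpatrick function as the graph, because `f` is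
defined everywhere (`gain_le_of_graph_subset`). Since `E[U | R]` need not be equal to `R`, the map
`(R, f(R))` is replaced by `X = E[Y | R]`, which has the value `E ψ_G(Y)`.

*From a pair without a gap to an equilibrium* (`exists_isEquilibrium_of_no_gap`). The order `R` is
the first component of `X`. Sections of `G` being convex, the second component may be replaced by
`E[V | R] = g(R)` without loss of value. The pricing function is `g` where its graph lies in `G`,
and elsewhere the Borel selection of minimal norm of `G` (`exists_measurable_selection`).

*Absence of a gap for an optimal plan* (`exists_isMaxSMonotone_of_isOptimalPlan`). Transporting a
small part `h γ` of an optimal plan `γ` to its barycenter `z` in `y` does not improve the value; to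
the first order this reads `∫ h gain(x, y) dγ ≥ q(z)` (`half_sForm_barycenter_le`). Hence the convex
set of the points `(∫ h y dγ, ∫ h gain(x, y) dγ)` is contained in the epigraph of `q`. Among the
convex subsets of the epigraph that contain it there is a maximal one, `M`, and the points `a` whose
affine functions `gain S a ·` lie below `M` form a maximal monotone set: they are monotone by
maximality of `M`, and maximal because, by a separation argument in the spirit of Minty, each
translate of `{(p, -p)}` contains such a point (`exists_isMaxSMonotone_gain_le`). The Fitzpatrick
function of this set is at most `gain S x y` for `γ`-almost every `(x, y)`.
-/

namespace BackwardTransport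

/-! ### The bilinear form, maximal monotone sets and the extended integral -/

section Form

variable {ι : Type*} [Fintype ι] (S : Matrix ι ι ℝ)

/-- The form `sForm S` as a continuous bilinear map. -/
noncomputable def sFormL : EuclideanSpace ℝ ι →L[ℝ] EuclideanSpace ℝ ι →L[ℝ] ℝ :=
  LinearMap.toContinuousBilinearMap <| LinearMap.mk₂ ℝ (sForm S)
    (fun x y z => by simp [sForm, add_mul, Finset.sum_add_distrib])
    (fun c x y => by simp [sForm, Finset.mul_sum, mul_assoc])
    (fun x y z => by simp [sForm, mul_add, Finset.sum_add_distrib])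
    (fun c x y => by simp [sForm, Finset.mul_sum, mul_left_comm])

theorem sFormL_apply (x y : EuclideanSpace ℝ ι) : sFormL S x y = sForm S x y := rfl

variable {S}

theorem sForm_comm (hS : S.IsSymm) (x y : EuclideanSpace ℝ ι) : sForm S x y = sForm S y x := by
  unfold sForm
  rw [Finset.sum_comm]
  refine Finset.sum_congr rfl fun i _ => Finset.sum_congr rfl fun j _ => ?_
  rw [← hS.apply i j]; ring

theorem sForm_add_left (x y z : EuclideanSpace ℝ ι) :
    sForm S (x + y) z = sForm S x z + sForm S y z := by
  simp only [← sFormL_apply, map_add, _root_.add_apply]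

theorem sForm_add_right (x y z : EuclideanSpace ℝ ι) :
    sForm S x (y + z) = sForm S x y + sForm S x z := by
  simp only [← sFormL_apply, map_add]

theorem sForm_sub_left (x y z : EuclideanSpace ℝ ι) :
    sForm S (x - y) z = sForm S x z - sForm S y z := by
  simp only [← sFormL_apply, map_sub, _root_.sub_apply]

theorem sForm_sub_right (x y z : EuclideanSpace ℝ ι) :
    sForm S x (y - z) = sForm S x y - sForm S x z := by
  simp only [← sFormL_apply, map_sub]

theorem sForm_smul_left (r : ℝ) (x y : EuclideanSpace ℝ ι) :
    sForm S (r • x) y = r * sForm S x y := by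
  simp only [← sFormL_apply, map_smul, _root_.smul_apply, smul_eq_mul]

theorem sForm_smul_right (r : ℝ) (x y : EuclideanSpace ℝ ι) :
    sForm S x (r • y) = r * sForm S x y := by
  simp only [← sFormL_apply, map_smul, smul_eq_mul]

theorem sForm_zero_left (x : EuclideanSpace ℝ ι) : sForm S 0 x = 0 := by
  simp only [← sFormL_apply, map_zero, _root_.zero_apply]

@[fun_prop]
theorem continuous_sForm {α : Type*} [TopologicalSpace α] {f g : α → EuclideanSpace ℝ ι}
    (hf : Continuous f) (hg : Continuous g) : Continuous fun a => sForm S (f a) (g a) := by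
  simp only [← sFormL_apply]; fun_prop

theorem sForm_sub_self (hS : S.IsSymm) (x y : EuclideanSpace ℝ ι) :
    sForm S (x - y) (x - y) = sForm S x x - 2 * sForm S x y + sForm S y y := by
  rw [sForm_sub_left, sForm_sub_right, sForm_sub_right, sForm_comm hS y x]; ring

/-- The gain `S(x, y) - ½ S(x, x)` whose supremum over `x ∈ G` is the Fitzpatrick function. -/
noncomputable def gain (S : Matrix ι ι ℝ) (x y : EuclideanSpace ℝ ι) : ℝ :=
  sForm S x y - 1 / 2 * sForm S x x

theorem gain_self (x : EuclideanSpace ℝ ι) : gain S x x = 1 / 2 * sForm S x x := by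
  unfold gain; ring

theorem gain_le_iff (hS : S.IsSymm) (x y : EuclideanSpace ℝ ι) :
    gain S x y ≤ 1 / 2 * sForm S y y ↔ 0 ≤ sForm S (x - y) (x - y) := by
  rw [sForm_sub_self hS, gain]; constructor <;> intro h <;> linarith

@[fun_prop]
theorem continuous_gain {α : Type*} [TopologicalSpace α] {f g : α → EuclideanSpace ℝ ι}
    (hf : Continuous f) (hg : Continuous g) : Continuous fun a => gain S (f a) (g a) := by
  unfold BackwardTransport.gain; fun_prop

theorem neg_norm_sq_le_sForm (S : Matrix ι ι ℝ) (x : EuclideanSpace ℝ ι) :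
    -(‖sFormL S‖ * ‖x‖ ^ 2) ≤ sForm S x x := by
  have h := (sFormL S).le_opNorm₂ x x
  rw [Real.norm_eq_abs, sFormL_apply] at h
  nlinarith [neg_abs_le (sForm S x x)]

end Form

section Maximal

variable {ι : Type*} [Fintype ι] {S : Matrix ι ι ℝ} {G : Set (EuclideanSpace ℝ ι)}

theorem IsSMonotone.exists_isMaxSMonotone (hG : IsSMonotone S G) :
    ∃ H, G ⊆ H ∧ IsMaxSMonotone S H := by
  obtain ⟨H, hGH, hH⟩ := zorn_subset_nonempty {H | IsSMonotone S H} (fun c hc hchain _ => by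
    refine ⟨⋃₀ c, ?_, fun s hs => Set.subset_sUnion_of_mem hs⟩
    rintro x ⟨s, hs, hx⟩ y ⟨t, ht, hy⟩
    rcases hchain.total hs ht with h | h
    · exact hc ht x (h hx) y hy
    · exact hc hs x hx y (h hy)) G hG
  exact ⟨H, hGH, hH⟩

theorem IsMaxSMonotone.mem_iff (hS : S.IsSymm) (hG : IsMaxSMonotone S G)
    {a : EuclideanSpace ℝ ι} : a ∈ G ↔ ∀ b ∈ G, gain S b a ≤ 1 / 2 * sForm S a a := by
  refine ⟨fun ha b hb => (gain_le_iff hS b a).2 (hG.prop b hb a ha), fun h => ?_⟩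
  refine hG.mem_of_prop_insert ?_
  have hneg : ∀ x y : EuclideanSpace ℝ ι, sForm S (x - y) (x - y) = sForm S (y - x) (y - x) := by
    intro x y
    rw [sForm_sub_self hS, sForm_sub_self hS, sForm_comm hS x y]; ring
  rintro x (rfl | hx) y (rfl | hy)
  · simp [sForm_zero_left]
  · rw [hneg]; exact (gain_le_iff hS y x).1 (h y hy)
  · exact (gain_le_iff hS x y).1 (h x hx)
  · exact hG.prop x hx y hy

theorem IsMaxSMonotone.isClosed (hS : S.IsSymm) (hG : IsMaxSMonotone S G) : IsClosed G := by
  have : G = ⋂ b ∈ G, {a | gain S b a ≤ 1 / 2 * sForm S a a} := by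
    ext a; simpa using hG.mem_iff hS
  rw [this]
  refine isClosed_biInter fun b _ => isClosed_le ?_ ?_ <;> fun_prop

theorem IsMaxSMonotone.nonempty (hS : S.IsSymm) (hG : IsMaxSMonotone S G) : G.Nonempty := by
  by_contra h
  rw [Set.not_nonempty_iff_eq_empty] at h
  have : (0 : EuclideanSpace ℝ ι) ∈ G := (hG.mem_iff hS).2 (by simp [h])
  simp [h] at this

theorem gain_le_fitzpatrick {a : EuclideanSpace ℝ ι} (ha : a ∈ G) (y : EuclideanSpace ℝ ι) :
    (gain S a y : EReal) ≤ fitzpatrick S G y :=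
  le_iSup₂ (f := fun x (_ : x ∈ G) => ((sForm S x y - 1 / 2 * sForm S x x : ℝ) : EReal)) a ha

theorem fitzpatrick_le_coe_iff {y : EuclideanSpace ℝ ι} {t : ℝ} :
    fitzpatrick S G y ≤ t ↔ ∀ a ∈ G, gain S a y ≤ t := by
  simp only [fitzpatrick, iSup_le_iff, EReal.coe_le_coe_iff, gain]

theorem measurable_fitzpatrick : Measurable (fitzpatrick S G) := by
  refine LowerSemicontinuous.measurable (lowerSemicontinuous_biSup fun x _ => ?_)
  refine Continuous.lowerSemicontinuous ?_
  exact continuous_coe_real_ereal.comp (by fun_prop)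

end Maximal

section ExtIntegral

variable {Ω : Type*} [MeasurableSpace Ω] {P : Measure Ω}

theorem extIntegral_mono {g h : Ω → EReal} (hgh : g ≤ᵐ[P] h) :
    extIntegral P g ≤ extIntegral P h := by
  refine EReal.sub_le_sub ?_ ?_
  · rw [EReal.coe_ennreal_le_coe_ennreal_iff]
    exact lintegral_mono_ae (hgh.mono fun ω hω => EReal.toENNReal_le_toENNReal hω)
  · rw [EReal.coe_ennreal_le_coe_ennreal_iff]
    exact lintegral_mono_ae (hgh.mono fun ω hω =>
      EReal.toENNReal_le_toENNReal (EReal.neg_le_neg_iff.2 hω))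

theorem extIntegral_congr {g h : Ω → EReal} (hgh : g =ᵐ[P] h) :
    extIntegral P g = extIntegral P h :=
  le_antisymm (extIntegral_mono hgh.le) (extIntegral_mono hgh.symm.le)

theorem extIntegral_coe {T : Ω → ℝ} (hT : Integrable T P) :
    extIntegral P (fun ω => (T ω : EReal)) = ((∫ ω, T ω ∂P : ℝ) : EReal) := by
  have h1 : (∫⁻ ω, ENNReal.ofReal (T ω) ∂P) ≠ ⊤ := hT.lintegral_lt_top.ne
  have h2 : (∫⁻ ω, ENNReal.ofReal (-T ω) ∂P) ≠ ⊤ := hT.neg.lintegral_lt_top.ne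
  rw [integral_eq_lintegral_pos_part_sub_lintegral_neg_part hT, EReal.coe_sub, extIntegral,
    EReal.coe_ennreal_toReal h1, EReal.coe_ennreal_toReal h2]
  simp only [← EReal.coe_neg, EReal.real_coe_toENNReal]

theorem extIntegral_map {E : Type*} [MeasurableSpace E] {Y : Ω → E} (hY : Measurable Y)
    {g : E → EReal} (hg : Measurable g) :
    extIntegral (P.map Y) g = extIntegral P (fun ω => g (Y ω)) := by
  rw [extIntegral, extIntegral, lintegral_map hg.ereal_toENNReal hY,
    lintegral_map (f := fun y => (-g y).toENNReal) hg.neg.ereal_toENNReal hY]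

/-- If the extended integral of a function with an integrable minorant is not `∞`, then the
function is almost surely equal to an integrable real function. -/
theorem exists_integrable_eq_of_extIntegral_ne_top {g : Ω → EReal} (hg : Measurable g)
    {L : Ω → ℝ} (hL : Integrable L P) (hLg : ∀ ω, (L ω : EReal) ≤ g ω)
    (htop : extIntegral P g ≠ ⊤) :
    ∃ T : Ω → ℝ, Integrable T P ∧ ∀ᵐ ω ∂P, g ω = T ω := by
  have hneg : (∫⁻ ω, (-g ω).toENNReal ∂P) ≠ ⊤ := by
    refine ne_top_of_le_ne_top hL.neg.lintegral_lt_top.ne (lintegral_mono fun ω => ?_)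
    have := EReal.toENNReal_le_toENNReal (EReal.neg_le_neg_iff.2 (hLg ω))
    rwa [← EReal.coe_neg, EReal.real_coe_toENNReal] at this
  have hpos : (∫⁻ ω, (g ω).toENNReal ∂P) ≠ ⊤ := by
    intro h
    apply htop
    rw [extIntegral, h, ← EReal.coe_ennreal_toReal hneg, EReal.coe_ennreal_top, EReal.top_sub_coe]
  have hlt : ∀ᵐ ω ∂P, g ω ≠ ⊤ := by
    filter_upwards [ae_lt_top hg.ereal_toENNReal hpos] with ω hω h
    simp [h] at hω
  have hbot : ∀ ω, g ω ≠ ⊥ := fun ω h => by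
    have := hLg ω
    simp [h] at this
  refine ⟨fun ω => (g ω).toReal, ⟨hg.ereal_toReal.aestronglyMeasurable, ?_⟩,
    hlt.mono fun ω hω => (EReal.coe_toReal hω (hbot ω)).symm⟩
  rw [hasFiniteIntegral_iff_norm]
  simp only [Real.norm_eq_abs]
  have hle : ∀ᵐ ω ∂P, ENNReal.ofReal |(g ω).toReal|
      ≤ (g ω).toENNReal + (-g ω).toENNReal := by
    filter_upwards [hlt] with ω hω
    lift g ω to ℝ using ⟨hω, hbot ω⟩ with t
    rw [← EReal.coe_neg, EReal.real_coe_toENNReal, EReal.real_coe_toENNReal, EReal.toReal_coe]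
    rcases abs_cases t with ⟨h, -⟩ | ⟨h, -⟩ <;> rw [h]
    · exact le_self_add
    · exact le_add_self
  refine (lintegral_mono_ae hle).trans_lt ?_
  rw [lintegral_add_left hg.ereal_toENNReal]
  exact ENNReal.add_lt_top.2 ⟨hpos.lt_top, hneg.lt_top⟩

end ExtIntegral

/-! ### Weak duality and complementary slackness -/

section L2

variable {Ω ι : Type*} {m : MeasurableSpace Ω} [mΩ : MeasurableSpace Ω] [Fintype ι]
  {S : Matrix ι ι ℝ} {P : Measure Ω}
  {G : Set (EuclideanSpace ℝ ι)} {X Y : Ω → EuclideanSpace ℝ ι}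

theorem integrable_sForm (S : Matrix ι ι ℝ) (hX : MemLp X 2 P) (hY : MemLp Y 2 P) :
    Integrable (fun ω => sForm S (X ω) (Y ω)) P :=
  memLp_one_iff_integrable.1 <|
    (sFormL S).memLp_of_bilin (p := 2) (q := 2) 1 hX hY

theorem integrable_gain (S : Matrix ι ι ℝ) (hX : MemLp X 2 P) (hY : MemLp Y 2 P) :
    Integrable (fun ω => gain S (X ω) (Y ω)) P :=
  (integrable_sForm S hX hY).sub ((integrable_sForm S hX hX).const_mul _)

theorem condExp_sForm [IsFiniteMeasure P]
    (hXm : AEStronglyMeasurable[m] X P) (hX : MemLp X 2 P) (hY : MemLp Y 2 P) :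
    P[fun ω => sForm S (X ω) (Y ω) | m] =ᵐ[P] fun ω => sForm S (X ω) (P[Y | m] ω) :=
  condExp_bilin_of_aestronglyMeasurable_left (sFormL S) hXm (integrable_sForm S hX hY)
    (hY.integrable one_le_two)

theorem integral_sForm_condExp [IsFiniteMeasure P] (hm : m ≤ mΩ)
    (hXm : AEStronglyMeasurable[m] X P) (hX : MemLp X 2 P) (hY : MemLp Y 2 P) :
    ∫ ω, sForm S (X ω) (P[Y | m] ω) ∂P = ∫ ω, sForm S (X ω) (Y ω) ∂P := by
  rw [← integral_condExp hm (f := fun ω => sForm S (X ω) (Y ω))]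
  exact integral_congr_ae (condExp_sForm hXm hX hY).symm

theorem ae_forall_mem_of_continuous {E : Type*} [TopologicalSpace E]
    [TopologicalSpace.PseudoMetrizableSpace E]
    [SecondCountableTopology E] {G : Set E} {F H : E → Ω → ℝ} (hF : ∀ ω, Continuous (F · ω))
    (hH : ∀ ω, Continuous (H · ω)) (h : ∀ a ∈ G, ∀ᵐ ω ∂P, F a ω ≤ H a ω) :
    ∀ᵐ ω ∂P, ∀ a ∈ G, F a ω ≤ H a ω := by
  obtain ⟨D, hDG, hDc, hGD⟩ :=
    (TopologicalSpace.IsSeparable.of_separableSpace G).exists_countable_dense_subset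
  filter_upwards [(ae_ball_iff hDc).2 fun a ha => h a (hDG ha)] with ω hω a ha
  exact closure_minimal (s := D) (t := {a | F a ω ≤ H a ω}) hω
    (isClosed_le (hF ω) (hH ω)) (hGD ha)

section Backward

variable [IsProbabilityMeasure P]

theorem integral_sForm_self_eq (hXm : Measurable X) (hX : MemLp X 2 P) (hY : MemLp Y 2 P)
    (hXY : P[Y | MeasurableSpace.comap X inferInstance] =ᵐ[P] X) :
    ∫ ω, sForm S (X ω) (X ω) ∂P = ∫ ω, sForm S (X ω) (Y ω) ∂P := by
  rw [← integral_sForm_condExp hXm.comap_le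
    (comap_measurable X).stronglyMeasurable.aestronglyMeasurable hX hY]
  exact integral_congr_ae (hXY.mono fun ω hω => by simp only [hω])

theorem integral_gain_eq (hXm : Measurable X) (hX : MemLp X 2 P) (hY : MemLp Y 2 P)
    (hXY : P[Y | MeasurableSpace.comap X inferInstance] =ᵐ[P] X) :
    ∫ ω, gain S (X ω) (Y ω) ∂P = 1 / 2 * ∫ ω, sForm S (X ω) (Y ω) ∂P := by
  unfold gain
  rw [integral_sub (integrable_sForm S hX hY) ((integrable_sForm S hX hX).const_mul _),
    integral_const_mul, integral_sForm_self_eq hXm hX hY hXY]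
  ring

/-- Conditional Jensen inequality for the Fitzpatrick function of `G`, applied along a countable
dense subset of `G`. -/
theorem ae_gain_le_condExp (hXm : Measurable X) (hY : MemLp Y 2 P)
    (hXY : P[Y | MeasurableSpace.comap X inferInstance] =ᵐ[P] X)
    {T : Ω → ℝ} (hT : Integrable T P)
    (hGT : ∀ᵐ ω ∂P, ∀ a ∈ G, gain S a (Y ω) ≤ T ω) :
    ∀ᵐ ω ∂P, ∀ a ∈ G, gain S a (X ω) ≤ P[T | MeasurableSpace.comap X inferInstance] ω := by
  refine ae_forall_mem_of_continuous (fun ω => by fun_prop) (fun ω => by fun_prop) fun a ha => ?_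
  have hle : (fun ω => gain S a (Y ω)) ≤ᵐ[P] T := hGT.mono fun ω hω => hω a ha
  have hc : MemLp (fun _ : Ω => a) 2 P := memLp_const a
  have h1 := condExp_mono (m := MeasurableSpace.comap X inferInstance)
    (integrable_gain S hc hY) hT hle
  have h2 := condExp_sub (integrable_sForm S hc hY)
    (integrable_const (1 / 2 * sForm S a a)) (MeasurableSpace.comap X inferInstance)
  have h3 := condExp_sForm (S := S) (m := MeasurableSpace.comap X inferInstance)
    (aestronglyMeasurable_const (b := a)) hc hY
  rw [condExp_const hXm.comap_le] at h2
  filter_upwards [h1, h2, h3, hXY] with ω e1 e2 e3 e4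
  calc gain S a (X ω) = _ := ?_
    _ ≤ _ := e1
  rw [Pi.sub_apply, e3, e4] at e2
  exact e2.symm

theorem ae_half_sForm_le_condExp (hXm : Measurable X) (hY : MemLp Y 2 P)
    (hXY : P[Y | MeasurableSpace.comap X inferInstance] =ᵐ[P] X)
    (hS : S.IsSymm) (hG : IsMaxSMonotone S G) {T : Ω → ℝ}
    (hT : Integrable T P) (hGT : ∀ᵐ ω ∂P, ∀ a ∈ G, gain S a (Y ω) ≤ T ω) :
    ∀ᵐ ω ∂P, 1 / 2 * sForm S (X ω) (X ω) ≤ P[T | MeasurableSpace.comap X inferInstance] ω := by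
  filter_upwards [ae_gain_le_condExp hXm hY hXY hT hGT] with ω hω
  by_contra! hlt
  have hmem : X ω ∈ G := (hG.mem_iff hS).2 fun b hb => (hω b hb).trans hlt.le
  have := hω _ hmem
  rw [gain_self] at this
  linarith

/-- The weak duality inequality between a backward martingale `(X, Y)` and an integrable majorant
of the Fitzpatrick function of a maximal `S`-monotone set. -/
theorem half_integral_sForm_le (hXm : Measurable X) (hX : MemLp X 2 P) (hY : MemLp Y 2 P)
    (hXY : P[Y | MeasurableSpace.comap X inferInstance] =ᵐ[P] X)
    (hS : S.IsSymm) (hG : IsMaxSMonotone S G) {T : Ω → ℝ}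
    (hT : Integrable T P) (hGT : ∀ᵐ ω ∂P, ∀ a ∈ G, gain S a (Y ω) ≤ T ω) :
    1 / 2 * ∫ ω, sForm S (X ω) (Y ω) ∂P ≤ ∫ ω, T ω ∂P := by
  rw [← integral_sForm_self_eq hXm hX hY hXY, ← integral_const_mul,
    ← integral_condExp hXm.comap_le (f := T)]
  exact integral_mono_ae ((integrable_sForm S hX hX).const_mul _) integrable_condExp
    (ae_half_sForm_le_condExp hXm hY hXY hS hG hT hGT)

/-- The case of equality in the weak duality inequality. -/
theorem ae_mem_and_eq_gain (hXm : Measurable X) (hX : MemLp X 2 P) (hY : MemLp Y 2 P)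
    (hXY : P[Y | MeasurableSpace.comap X inferInstance] =ᵐ[P] X)
    (hS : S.IsSymm) (hG : IsMaxSMonotone S G) {T : Ω → ℝ}
    (hT : Integrable T P) (hGT : ∀ᵐ ω ∂P, ∀ a ∈ G, gain S a (Y ω) ≤ T ω)
    (hle : ∫ ω, T ω ∂P ≤ 1 / 2 * ∫ ω, sForm S (X ω) (Y ω) ∂P) :
    ∀ᵐ ω ∂P, X ω ∈ G ∧ T ω = gain S (X ω) (Y ω) := by
  have heq := le_antisymm hle (half_integral_sForm_le hXm hX hY hXY hS hG hT hGT)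
  have hcond := ae_half_sForm_le_condExp hXm hY hXY hS hG hT hGT
  have hcond_eq := (integral_eq_iff_of_ae_le ((integrable_sForm S hX hX).const_mul _)
    integrable_condExp hcond).1 (by
      rw [integral_const_mul, integral_sForm_self_eq hXm hX hY hXY, ← heq,
        integral_condExp hXm.comap_le])
  have hmem : ∀ᵐ ω ∂P, X ω ∈ G := by
    filter_upwards [hcond_eq, ae_gain_le_condExp hXm hY hXY hT hGT] with ω h1 h2
    exact (hG.mem_iff hS).2 fun b hb => (h2 b hb).trans h1.ge
  have hgain : (fun ω => gain S (X ω) (Y ω)) ≤ᵐ[P] T := by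
    filter_upwards [hmem, hGT] with ω h1 h2 using h2 _ h1
  have hgain_eq := (integral_eq_iff_of_ae_le (integrable_gain S hX hY) hT hgain).1 (by
    rw [heq, integral_gain_eq hXm hX hY hXY])
  filter_upwards [hmem, hgain_eq] with ω h1 h2 using ⟨h1, h2.symm⟩

end Backward

theorem exists_integrable_eq_fitzpatrick (hS : S.IsSymm) (hG : IsMaxSMonotone S G)
    [IsFiniteMeasure P] (hYm : Measurable Y) (hY : MemLp Y 2 P)
    (htop : extIntegral (P.map Y) (fitzpatrick S G) ≠ ⊤) :
    ∃ T : Ω → ℝ, Integrable T P ∧ (∀ᵐ ω ∂P, ∀ a ∈ G, gain S a (Y ω) ≤ T ω) ∧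
      extIntegral (P.map Y) (fitzpatrick S G) = ((∫ ω, T ω ∂P : ℝ) : EReal) := by
  obtain ⟨a, ha⟩ := hG.nonempty hS
  rw [extIntegral_map hYm measurable_fitzpatrick] at htop ⊢
  obtain ⟨T, hT, hgT⟩ := exists_integrable_eq_of_extIntegral_ne_top
    (measurable_fitzpatrick.comp hYm) (integrable_gain S (memLp_const a) hY)
    (fun ω => gain_le_fitzpatrick ha (Y ω)) htop
  refine ⟨T, hT, hgT.mono fun ω hω => fitzpatrick_le_coe_iff.1 hω.le, ?_⟩
  rw [← extIntegral_coe hT]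
  exact extIntegral_congr hgT

theorem extIntegral_fitzpatrick_le (hYm : Measurable Y) {T : Ω → ℝ} (hT : Integrable T P)
    (hGT : ∀ᵐ ω ∂P, ∀ a ∈ G, gain S a (Y ω) ≤ T ω) :
    extIntegral (P.map Y) (fitzpatrick S G) ≤ ((∫ ω, T ω ∂P : ℝ) : EReal) := by
  rw [extIntegral_map hYm measurable_fitzpatrick, ← extIntegral_coe hT]
  exact extIntegral_mono (hGT.mono fun ω hω => fitzpatrick_le_coe_iff.2 hω)

variable [IsProbabilityMeasure P]

/-- Weak duality. -/
theorem half_integral_sForm_le_extIntegral (hS : S.IsSymm) (hG : IsMaxSMonotone S G)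
    (hXm : Measurable X) (hX : MemLp X 2 P) (hYm : Measurable Y) (hY : MemLp Y 2 P)
    (hXY : P[Y | MeasurableSpace.comap X inferInstance] =ᵐ[P] X) :
    ((1 / 2 * ∫ ω, sForm S (X ω) (Y ω) ∂P : ℝ) : EReal)
      ≤ extIntegral (P.map Y) (fitzpatrick S G) := by
  by_cases htop : extIntegral (P.map Y) (fitzpatrick S G) = ⊤
  · rw [htop]; exact le_top
  obtain ⟨T, hT, hGT, heq⟩ := exists_integrable_eq_fitzpatrick hS hG hYm hY htop
  rw [heq, EReal.coe_le_coe_iff]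
  exact half_integral_sForm_le hXm hX hY hXY hS hG hT hGT

/-- Complementary slackness: without a duality gap, `X` takes values in `G` and attains the
Fitzpatrick function of `G` at `Y`. -/
theorem ae_mem_and_gain_le_gain (hS : S.IsSymm) (hG : IsMaxSMonotone S G)
    (hXm : Measurable X) (hX : MemLp X 2 P) (hYm : Measurable Y) (hY : MemLp Y 2 P)
    (hXY : P[Y | MeasurableSpace.comap X inferInstance] =ᵐ[P] X)
    (hgap : extIntegral (P.map Y) (fitzpatrick S G)
      ≤ ((1 / 2 * ∫ ω, sForm S (X ω) (Y ω) ∂P : ℝ) : EReal)) :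
    ∀ᵐ ω ∂P, X ω ∈ G ∧ ∀ a ∈ G, gain S a (Y ω) ≤ gain S (X ω) (Y ω) := by
  obtain ⟨T, hT, hGT, heq⟩ := exists_integrable_eq_fitzpatrick hS hG hYm hY
    (hgap.trans_lt (EReal.coe_lt_top _)).ne
  rw [heq, EReal.coe_le_coe_iff] at hgap
  filter_upwards [ae_mem_and_eq_gain hXm hX hY hXY hS hG hT hGT hgap, hGT] with ω h1 h2
  exact ⟨h1.1, fun a ha => h1.2 ▸ h2 a ha⟩

/-- The law of a backward martingale `(X, Y)` is a backward plan. -/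
theorem isBackwardPlan_map (hXm : Measurable X) (hX : MemLp X 2 P) (hYm : Measurable Y)
    (hY : MemLp Y 2 P) (hXY : P[Y | MeasurableSpace.comap X inferInstance] =ᵐ[P] X) :
    IsBackwardPlan (P.map Y) (P.map fun ω => (X ω, Y ω)) := by
  have hXYm : Measurable fun ω => (X ω, Y ω) := hXm.prodMk hYm
  have hprob : IsProbabilityMeasure (P.map fun ω => (X ω, Y ω)) :=
    Measure.isProbabilityMeasure_map hXYm.aemeasurable
  have h1 : MemLp Prod.fst 2 (P.map fun ω => (X ω, Y ω)) :=
    (memLp_map_measure_iff measurable_fst.aestronglyMeasurable hXYm.aemeasurable).2 hX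
  have h2 : MemLp Prod.snd 2 (P.map fun ω => (X ω, Y ω)) :=
    (memLp_map_measure_iff measurable_snd.aestronglyMeasurable hXYm.aemeasurable).2 hY
  refine ⟨hprob, h1, h2, ?_, ?_⟩
  · rw [Measure.map_map measurable_snd hXYm]; rfl
  · refine (ae_eq_condExp_of_forall_setIntegral_eq measurable_fst.comap_le
      (h2.integrable one_le_two) (fun _ _ _ => (h1.integrable one_le_two).integrableOn) ?_
      (comap_measurable Prod.fst).stronglyMeasurable.aestronglyMeasurable).symm
    rintro s ⟨B, hB, rfl⟩ -
    rw [setIntegral_map (measurable_fst hB) measurable_fst.aestronglyMeasurable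
      hXYm.aemeasurable, setIntegral_map (measurable_fst hB) measurable_snd.aestronglyMeasurable
      hXYm.aemeasurable]
    change ∫ ω in X ⁻¹' B, X ω ∂P = ∫ ω in X ⁻¹' B, Y ω ∂P
    rw [← setIntegral_condExp hXm.comap_le (hY.integrable one_le_two) ⟨B, hB, rfl⟩]
    exact setIntegral_congr_ae (hXm hB) (hXY.mono fun ω hω _ => hω.symm)

/-- A version of any conditional expectation of `Y` is the conditional expectation of `Y` given
itself. -/
theorem condExp_comap_eq_self (hm : m ≤ mΩ)
    (hXm : Measurable[m] X) (hXY : P[Y | m] =ᵐ[P] X) (hX : Integrable X P) :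
    P[Y | MeasurableSpace.comap X inferInstance] =ᵐ[P] X := by
  have hle : MeasurableSpace.comap X inferInstance ≤ m := hXm.comap_le
  have h1 := condExp_condExp_of_le (f := Y) (μ := P) hle hm
  have h2 := condExp_congr_ae (m := MeasurableSpace.comap X inferInstance) hXY
  rw [condExp_of_stronglyMeasurable (hle.trans hm) (comap_measurable X).stronglyMeasurable hX]
    at h2
  exact h1.symm.trans h2

/-- A pair without duality gap consists of an optimal map and a dual-optimal set, and the law of
the map together with `Y` is an optimal plan. -/
theorem optimal_of_no_gap (hS : S.IsSymm) (hG : IsMaxSMonotone S G) (hYm : Measurable Y)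
    (hY : MemLp Y 2 P) (hX : IsBackwardMap P Y X)
    (hgap : extIntegral (P.map Y) (fitzpatrick S G)
      ≤ ((1 / 2 * ∫ ω, sForm S (X ω) (Y ω) ∂P : ℝ) : EReal)) :
    IsOptimalMap S P Y X ∧ IsDualOptimal S (P.map Y) G ∧
      IsOptimalPlan S (P.map Y) (P.map fun ω => (X ω, Y ω)) := by
  refine ⟨⟨hX, fun X' hX' => ?_⟩, ⟨hG, fun H hH => hgap.trans ?_⟩,
    isBackwardPlan_map hX.measurable hX.memLp hYm hY hX.martingale, fun γ hγ => ?_⟩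
  · rw [← EReal.coe_le_coe_iff]
    exact (half_integral_sForm_le_extIntegral hS hG hX'.measurable hX'.memLp hYm hY
      hX'.martingale).trans hgap
  · exact half_integral_sForm_le_extIntegral hS hH hX.measurable hX.memLp hYm hY hX.martingale
  · have := hγ.isProb
    rw [← EReal.coe_le_coe_iff]
    have h := half_integral_sForm_le_extIntegral hS hG measurable_fst hγ.memLp_fst
      measurable_snd hγ.memLp_snd hγ.martingale
    rw [hγ.marginal] at h
    rw [integral_map (hX.measurable.prodMk hYm).aemeasurable
      (Continuous.aestronglyMeasurable (by fun_prop))]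
    exact h.trans hgap

end L2

/-! ### Maximal monotone sets below a convex set: Minty's argument -/

section Std

variable {m : ℕ}

/-- The projection of `ℝ^{2m}` on the first `m` coordinates. -/
noncomputable def fstL (m : ℕ) :
    EuclideanSpace ℝ (Fin m ⊕ Fin m) →L[ℝ] EuclideanSpace ℝ (Fin m) :=
  LinearMap.toContinuousLinearMap
    { toFun := fun x => WithLp.toLp 2 fun i => x (Sum.inl i)
      map_add' := fun x y => by ext i; simp
      map_smul' := fun c x => by ext i; simp }

/-- The projection of `ℝ^{2m}` on the last `m` coordinates. -/
noncomputable def sndL (m : ℕ) :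
    EuclideanSpace ℝ (Fin m ⊕ Fin m) →L[ℝ] EuclideanSpace ℝ (Fin m) :=
  LinearMap.toContinuousLinearMap
    { toFun := fun x => WithLp.toLp 2 fun i => x (Sum.inr i)
      map_add' := fun x y => by ext i; simp
      map_smul' := fun c x => by ext i; simp }

@[simp]
theorem fstL_pair (u v : EuclideanSpace ℝ (Fin m)) : fstL m (pair u v) = u := by
  ext i; simp [fstL, pair]

@[simp]
theorem sndL_pair (u v : EuclideanSpace ℝ (Fin m)) : sndL m (pair u v) = v := by
  ext i; simp [sndL, pair]

@[simp]
theorem pair_fstL_sndL (x : EuclideanSpace ℝ (Fin m ⊕ Fin m)) :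
    pair (fstL m x) (sndL m x) = x := by
  ext i; rcases i with i | i <;> simp [fstL, sndL, pair]

theorem continuous_pair : Continuous fun p : EuclideanSpace ℝ (Fin m) × EuclideanSpace ℝ (Fin m) =>
    pair p.1 p.2 := by
  refine (PiLp.continuous_toLp 2 _).comp (continuous_pi fun i => ?_)
  rcases i with i | i <;> simp only [Sum.elim_inl, Sum.elim_inr] <;> fun_prop

theorem isSymm_stdMatrix : (stdMatrix m).IsSymm := by
  simp [Matrix.IsSymm, stdMatrix, Matrix.fromBlocks_transpose]

theorem sForm_stdMatrix (x y : EuclideanSpace ℝ (Fin m ⊕ Fin m)) :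
    sForm (stdMatrix m) x y = ⟪sndL m x, fstL m y⟫ + ⟪fstL m x, sndL m y⟫ := by
  simp [sForm, stdMatrix, Fintype.sum_sum_type, fstL, sndL, PiLp.inner_apply, Matrix.one_apply,
    mul_comm, add_comm]

theorem gain_pair (r s u v : EuclideanSpace ℝ (Fin m)) :
    gain (stdMatrix m) (pair r s) (pair u v) = ⟪r - u, v - s⟫ + ⟪u, v⟫ := by
  simp only [gain, sForm_stdMatrix, fstL_pair, sndL_pair, inner_sub_left, inner_sub_right,
    real_inner_comm r s, real_inner_comm u s]
  ring

end Std

section Minty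

/-- Separation of a convex subset of the epigraph of `-¼‖·‖²` from the strict hypograph of this
function by the graph of an affine function. -/
theorem exists_affine_le_of_neg_sq_le {F : Type*} [NormedAddCommGroup F] [InnerProductSpace ℝ F]
    [CompleteSpace F] {A : Set (F × ℝ)} (hA : Convex ℝ A) (hne : A.Nonempty)
    (hsq : ∀ a ∈ A, -(1 / 4 * ‖a.1‖ ^ 2) ≤ a.2) :
    ∃ p : F, ∀ a ∈ A, ⟪p, a.1⟫ + ‖p‖ ^ 2 ≤ a.2 := by
  set O : Set (F × ℝ) := {a | a.1 ∈ Set.univ ∧ a.2 < -(1 / 4 * ‖a.1‖ ^ 2)} with hO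
  have hconc : ConcaveOn ℝ Set.univ fun w : F => -(1 / 4 * ‖w‖ ^ 2) := by
    have h1 : ConvexOn ℝ Set.univ fun w : F => ‖w‖ ^ 2 :=
      convexOn_univ_norm.pow (fun _ _ => norm_nonneg _) 2
    exact (h1.smul (by norm_num : (0 : ℝ) ≤ 1 / 4)).neg
  have hOc : Convex ℝ O := hconc.convex_strict_hypograph
  have hOo : IsOpen O := by
    simp only [hO, Set.mem_univ, true_and]
    exact isOpen_lt (by fun_prop) (by fun_prop)
  have hdisj : Disjoint O A := by
    rw [Set.disjoint_left]
    intro a ha haA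
    exact (hsq a haA).not_gt ha.2
  obtain ⟨f, u, hfO, hfA⟩ := geometric_hahn_banach_open hOc hOo hA hdisj
  have hf : ∀ w t, f (w, t) = f (w, 0) + t * f (0, 1) := by
    intro w t
    have : ((w, t) : F × ℝ) = (w, 0) + t • (0, 1) := by simp
    rw [this, map_add, map_smul, smul_eq_mul]
  set l := f (0, 1) with hl
  have hmem : ∀ w : F, ∀ d : ℝ, 0 < d → f (w, 0) + (-(1 / 4 * ‖w‖ ^ 2) - d) * l < u := by
    intro w d hd
    rw [← hf]
    exact hfO _ ⟨trivial, by simpa using hd⟩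
  have hl0 : 0 ≤ l := by
    by_contra! hneg
    have hpos : 0 ≤ |u| / (-l) := div_nonneg (abs_nonneg u) (by linarith)
    have h0 := hmem 0 (1 + |u| / (-l)) (by linarith)
    have hz : f ((0 : F), (0 : ℝ)) = 0 := map_zero f
    rw [hz] at h0
    have : |u| / (-l) * (-l) = |u| := div_mul_cancel₀ _ (by linarith)
    simp only [norm_zero] at h0
    nlinarith [le_abs_self u]
  obtain ⟨a0, ha0⟩ := hne
  have hlpos : 0 < l := by
    refine lt_of_le_of_ne hl0 fun h => ?_
    have hlt : ∀ w, f (w, 0) < u := fun w => by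
      have := hmem w 1 one_pos
      rwa [← h, mul_zero, add_zero] at this
    have h1 := hfA a0 ha0
    have h2 : f a0 = f (a0.1, 0) := by
      conv_lhs => rw [show a0 = (a0.1, a0.2) from rfl, hf, ← h, mul_zero, add_zero]
    linarith [hlt a0.1]
  -- the Riesz representative of the slope of the separating hyperplane
  set g : F := (InnerProductSpace.toDual ℝ F).symm (f.comp (ContinuousLinearMap.inl ℝ F ℝ)) with hg
  have hgf : ∀ w, f (w, 0) = ⟪g, w⟫ := fun w => by
    rw [hg, InnerProductSpace.toDual_symm_apply]; rfl
  obtain ⟨p, hgp⟩ : ∃ p, g = l • p := ⟨l⁻¹ • g, (smul_inv_smul₀ hlpos.ne' g).symm⟩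
  refine ⟨-p, fun a ha => ?_⟩
  -- the concave function `⟪p, w⟫ - ¼‖w‖²` attains its maximum `‖p‖²` at `w = 2p`
  have hu : l * ‖p‖ ^ 2 ≤ u := by
    refine le_of_forall_pos_lt_add fun e he => ?_
    have := hmem ((2 : ℝ) • p) (e / l) (by positivity)
    rw [hgf, hgp, real_inner_smul_left, real_inner_smul_right, real_inner_self_eq_norm_sq,
      norm_smul, Real.norm_eq_abs, abs_two] at this
    have hel : e / l * l = e := div_mul_cancel₀ _ hlpos.ne'
    nlinarith
  have hfa := hfA a ha
  rw [show a = (a.1, a.2) from rfl, hf, hgf, hgp, real_inner_smul_left] at hfa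
  rw [inner_neg_left, norm_neg]
  have : l * (-⟪p, a.1⟫ + ‖p‖ ^ 2) ≤ l * a.2 := by linarith
  exact le_of_mul_le_mul_left this hlpos

variable {m : ℕ}

/-- A convex set in the epigraph of `½ S(z, z)` admits at each point `x₀` an affine minorant
`S(a, ·) - ½ S(a, a)` with `a - x₀` of the form `(p, -p)`. This is the counterpart of Minty's
surjectivity theorem. -/
theorem exists_gain_le_of_convex {K : Set (EuclideanSpace ℝ (Fin m ⊕ Fin m) × ℝ)}
    (hK : Convex ℝ K) (hne : K.Nonempty)
    (hepi : ∀ k ∈ K, 1 / 2 * sForm (stdMatrix m) k.1 k.1 ≤ k.2)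
    (x₀ : EuclideanSpace ℝ (Fin m ⊕ Fin m)) :
    ∃ p : EuclideanSpace ℝ (Fin m), ∀ k ∈ K,
      gain (stdMatrix m) (x₀ + pair p (-p)) k.1 ≤ k.2 := by
  set S := stdMatrix m
  have hS : S.IsSymm := isSymm_stdMatrix
  -- the affine change of variables that moves `x₀` to the origin
  let L : EuclideanSpace ℝ (Fin m ⊕ Fin m) × ℝ →ₗ[ℝ] EuclideanSpace ℝ (Fin m) × ℝ :=
    LinearMap.prod ((sndL m - fstL m).toLinearMap ∘ₗ LinearMap.fst ℝ _ _)
      (LinearMap.snd ℝ _ _ - (sFormL S x₀).toLinearMap ∘ₗ LinearMap.fst ℝ _ _)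
  let c : EuclideanSpace ℝ (Fin m) × ℝ := (-(sndL m - fstL m) x₀, 1 / 2 * sForm S x₀ x₀)
  have hLc : ∀ k, c + L k = ((sndL m - fstL m) (k.1 - x₀),
      k.2 - sForm S x₀ k.1 + 1 / 2 * sForm S x₀ x₀) := by
    intro k
    ext1
    · simp [L, c]; abel
    · simp [L, c, sFormL_apply]; ring
  obtain ⟨p, hp⟩ := exists_affine_le_of_neg_sq_le (A := (fun a => c + a) '' (L '' K))
    ((hK.linear_image L).translate c) ((hne.image _).image _) (by
      rintro _ ⟨_, ⟨k, hk, rfl⟩, rfl⟩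
      simp only [hLc]
      have h1 := hepi k hk
      have h2 := sForm_sub_self hS k.1 x₀
      rw [sForm_comm hS k.1 x₀] at h2
      have h3 : sForm S (k.1 - x₀) (k.1 - x₀)
          = 2 * ⟪fstL m (k.1 - x₀), sndL m (k.1 - x₀)⟫ := by
        rw [sForm_stdMatrix, real_inner_comm]; ring
      have h4 : ‖(sndL m - fstL m) (k.1 - x₀)‖ ^ 2
          = ‖sndL m (k.1 - x₀) + fstL m (k.1 - x₀)‖ ^ 2
            - 4 * ⟪fstL m (k.1 - x₀), sndL m (k.1 - x₀)⟫ := by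
        rw [_root_.sub_apply, @norm_sub_sq_real, @norm_add_sq_real, real_inner_comm]; ring
      rw [h4]
      nlinarith [sq_nonneg ‖sndL m (k.1 - x₀) + fstL m (k.1 - x₀)‖])
  refine ⟨p, fun k hk => ?_⟩
  have h := hp _ ⟨_, ⟨k, hk, rfl⟩, rfl⟩
  simp only [hLc] at h
  have h1 : ∀ z, sForm S (pair p (-p)) z = ⟪p, (sndL m - fstL m) z⟫ := by
    intro z
    rw [sForm_stdMatrix, fstL_pair, sndL_pair, _root_.sub_apply, inner_sub_right, inner_neg_left]
    ring
  have h2 : sForm S (pair p (-p)) (pair p (-p)) = -(2 * ‖p‖ ^ 2) := by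
    rw [h1, _root_.sub_apply, fstL_pair, sndL_pair, inner_sub_right, inner_neg_right,
      real_inner_self_eq_norm_sq]
    ring
  rw [gain, sForm_add_left, sForm_add_left, sForm_add_right, sForm_add_right,
    sForm_comm hS x₀ (pair p (-p)), h2, h1, h1]
  rw [map_sub, inner_sub_right] at h
  linarith

/-- A convex set contained in the epigraph of `½ S(z, z)` stays above the Fitzpatrick function of
some maximal `S`-monotone set. -/
theorem exists_isMaxSMonotone_gain_le {K : Set (EuclideanSpace ℝ (Fin m ⊕ Fin m) × ℝ)}
    (hK : Convex ℝ K) (hne : K.Nonempty)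
    (hepi : ∀ k ∈ K, 1 / 2 * sForm (stdMatrix m) k.1 k.1 ≤ k.2) :
    ∃ H, IsMaxSMonotone (stdMatrix m) H ∧
      ∀ a ∈ H, ∀ k ∈ K, gain (stdMatrix m) a k.1 ≤ k.2 := by
  set S := stdMatrix m
  have hS : S.IsSymm := isSymm_stdMatrix
  -- a maximal convex subset `M` of the epigraph, playing the part of a minimal convex function
  obtain ⟨M, hKM, hM⟩ := zorn_subset_nonempty
    {M : Set (EuclideanSpace ℝ (Fin m ⊕ Fin m) × ℝ) |
      Convex ℝ M ∧ ∀ k ∈ M, 1 / 2 * sForm S k.1 k.1 ≤ k.2}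
    (fun c hc hchain _ => ⟨⋃₀ c, ⟨hchain.directedOn.convex_sUnion fun s hs => (hc hs).1, by
        rintro k ⟨s, hs, hk⟩
        exact (hc hs).2 k hk⟩, fun s hs => Set.subset_sUnion_of_mem hs⟩) K ⟨hK, hepi⟩
  obtain ⟨hMc, hMe⟩ := hM.prop
  have hMne := hne.mono hKM
  set H : Set (EuclideanSpace ℝ (Fin m ⊕ Fin m)) := {a | ∀ k ∈ M, gain S a k.1 ≤ k.2} with hH
  -- by maximality, `M` contains the points of the graph of `½ S(z, z)` over `H`
  have hgraph : ∀ a ∈ H, (a, 1 / 2 * sForm S a a) ∈ M := by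
    intro a ha
    have hins : convexHull ℝ (insert (a, 1 / 2 * sForm S a a) M) ⊆ M := by
      refine hM.le_of_ge ⟨convex_convexHull ℝ _, ?_⟩
        ((Set.subset_insert _ _).trans (subset_convexHull ℝ _))
      intro k hk
      rw [convexHull_insert hMne, hMc.convexHull_eq, mem_convexJoin] at hk
      obtain ⟨_, rfl, k', hk', s, t, hs, ht, hst, rfl⟩ := hk
      have h1 := ha k' hk'
      have h2 := hMe k' hk'
      simp only [Prod.fst_add, Prod.smul_fst, Prod.snd_add, Prod.smul_snd, smul_eq_mul,
        sForm_add_left, sForm_add_right, sForm_smul_left, sForm_smul_right,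
        sForm_comm hS k'.1 a]
      rw [gain] at h1
      obtain rfl : t = 1 - s := by linarith
      nlinarith [mul_le_mul_of_nonneg_left h1 (mul_nonneg hs ht),
        mul_le_mul_of_nonneg_left h2 (mul_nonneg ht ht)]
    exact hins (subset_convexHull ℝ _ (Set.mem_insert _ _))
  refine ⟨H, ⟨fun a ha b hb => (gain_le_iff hS a b).1 (ha _ (hgraph b hb)), fun H' hH' hHH' => ?_⟩,
    fun a ha k hk => ha k (hKM hk)⟩
  intro x hx
  obtain ⟨p, hp⟩ := exists_gain_le_of_convex hMc hMne hMe x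
  have hmono := hH' _ (hHH' hp) _ hx
  rw [add_sub_cancel_left, sForm_stdMatrix, fstL_pair, sndL_pair, inner_neg_left,
    inner_neg_right, real_inner_self_eq_norm_sq] at hmono
  have hp0 : p = 0 := by
    rw [← norm_eq_zero]
    nlinarith [norm_nonneg p]
  have hz : x + pair p (-p) = x := by
    rw [hp0]
    ext i
    rcases i with i | i <;> simp [pair]
  rwa [hz] at hp

end Minty

/-! ### Splitting the mass of a plan -/

section Split

variable {E F : Type*} [MeasurableSpace E] [MeasurableSpace F]

/-- The measure obtained from `γ(dx, dy)` by moving the fraction `g(x, y)` of the mass at `(x, y)`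
to `(z, y)`. -/
noncomputable def splitMeasure (γ : Measure (E × F)) (g : E × F → ℝ) (z : E) :
    Measure (E × F) :=
  γ.withDensity (fun p => ENNReal.ofReal (1 - g p)) +
    (γ.withDensity fun p => ENNReal.ofReal (g p)).map fun p => (z, p.2)

variable {γ : Measure (E × F)} {g : E × F → ℝ}

theorem withDensity_ofReal_le {f : E × F → ℝ} (hf : ∀ p, f p ≤ 1) :
    γ.withDensity (fun p => ENNReal.ofReal (f p)) ≤ γ := by
  conv_rhs => rw [← withDensity_one (μ := γ)]
  exact withDensity_mono (ae_of_all _ fun p => by simpa using hf p)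

theorem map_snd_splitMeasure (hg : Measurable g) (h0 : ∀ p, 0 ≤ g p)
    (h1 : ∀ p, g p ≤ 1 / 2) (z : E) : (splitMeasure γ g z).map Prod.snd = γ.map Prod.snd := by
  have hz : Measurable fun p : E × F => (z, p.2) := measurable_const.prodMk measurable_snd
  rw [splitMeasure, Measure.map_add _ _ measurable_snd, Measure.map_map measurable_snd hz]
  change _ + Measure.map Prod.snd _ = _
  rw [← Measure.map_add _ _ measurable_snd,
    ← withDensity_add_left (f := fun p => ENNReal.ofReal (1 - g p))
      (by fun_prop : Measurable fun p => ENNReal.ofReal (1 - g p))]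
  congr 1
  conv_rhs => rw [← withDensity_one (μ := γ)]
  congr 1
  funext p
  rw [Pi.add_apply, ← ENNReal.ofReal_add (by linarith [h1 p]) (h0 p)]
  simp

theorem isProbabilityMeasure_splitMeasure (hg : Measurable g) (h0 : ∀ p, 0 ≤ g p)
    (h1 : ∀ p, g p ≤ 1 / 2) (z : E) [IsProbabilityMeasure γ] :
    IsProbabilityMeasure (splitMeasure γ g z) := by
  have h : IsProbabilityMeasure ((splitMeasure γ g z).map Prod.snd) := by
    rw [map_snd_splitMeasure hg h0 h1 z]
    exact Measure.isProbabilityMeasure_map measurable_snd.aemeasurable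
  exact ⟨by have := h.measure_univ; rwa [Measure.map_apply measurable_snd .univ] at this⟩

theorem integrable_splitMeasure (h0 : ∀ p, 0 ≤ g p)
    (h1 : ∀ p, g p ≤ 1 / 2) (z : E) {f : E × F → ℝ} (hf : Measurable f) (hfγ : Integrable f γ)
    (hfz : Integrable (fun p => f (z, p.2)) γ) : Integrable f (splitMeasure γ g z) := by
  have hz : Measurable fun p : E × F => (z, p.2) := measurable_const.prodMk measurable_snd
  refine (hfγ.mono_measure ?_).add_measure ((integrable_map_measure hf.aestronglyMeasurable
    hz.aemeasurable).2 (hfz.mono_measure ?_))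
  · exact withDensity_ofReal_le fun p => by linarith [h0 p]
  · exact withDensity_ofReal_le fun p => by linarith [h1 p]

theorem integral_splitMeasure (hg : Measurable g) (h0 : ∀ p, 0 ≤ g p)
    (h1 : ∀ p, g p ≤ 1 / 2) (z : E) {f : E × F → ℝ} (hf : Measurable f) (hfγ : Integrable f γ)
    (hfz : Integrable (fun p => f (z, p.2)) γ) :
    ∫ p, f p ∂(splitMeasure γ g z) = ∫ p, (1 - g p) * f p ∂γ + ∫ p, g p * f (z, p.2) ∂γ := by
  have hz : Measurable fun p : E × F => (z, p.2) := measurable_const.prodMk measurable_snd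
  have hd1 : γ.withDensity (fun p => ENNReal.ofReal (1 - g p)) ≤ γ :=
    withDensity_ofReal_le fun p => by linarith [h0 p]
  have hd2 : γ.withDensity (fun p => ENNReal.ofReal (g p)) ≤ γ :=
    withDensity_ofReal_le fun p => by linarith [h1 p]
  rw [splitMeasure, integral_add_measure (hfγ.mono_measure hd1)
    ((integrable_map_measure hf.aestronglyMeasurable hz.aemeasurable).2 (hfz.mono_measure hd2)),
    integral_map hz.aemeasurable hf.aestronglyMeasurable,
    integral_withDensity_eq_integral_toReal_smul (by fun_prop) (ae_of_all _ fun _ => by simp),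
    integral_withDensity_eq_integral_toReal_smul (by fun_prop) (ae_of_all _ fun _ => by simp)]
  congr 1
  · refine integral_congr_ae (ae_of_all _ fun p => ?_)
    simp only [smul_eq_mul]
    rw [ENNReal.toReal_ofReal (by linarith [h1 p])]
  · refine integral_congr_ae (ae_of_all _ fun p => ?_)
    simp only [smul_eq_mul]
    rw [ENNReal.toReal_ofReal (h0 p)]

theorem memLp_splitMeasure (h0 : ∀ p, 0 ≤ g p)
    (h1 : ∀ p, g p ≤ 1 / 2) (z : E) {W : Type*} [NormedAddCommGroup W] [MeasurableSpace W]
    [BorelSpace W]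
    [SecondCountableTopology W] {f : E × F → W} (hf : Measurable f) (hfγ : MemLp f 2 γ)
    (hfz : MemLp (fun p => f (z, p.2)) 2 γ) : MemLp f 2 (splitMeasure γ g z) := by
  rw [memLp_two_iff_integrable_sq_norm hf.aestronglyMeasurable]
  exact integrable_splitMeasure h0 h1 z (by fun_prop)
    ((memLp_two_iff_integrable_sq_norm hf.aestronglyMeasurable).1 hfγ)
    ((memLp_two_iff_integrable_sq_norm hfz.1).1 hfz)

theorem le_two_smul_splitMeasure (hg : Measurable g)
    (h1 : ∀ p, g p ≤ 1 / 2) (z : E) : γ ≤ (2 : ℝ≥0∞) • splitMeasure γ g z := by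
  have hle : γ ≤ (2 : ℝ≥0∞) • γ.withDensity (fun p => ENNReal.ofReal (1 - g p)) := by
    rw [← withDensity_smul _ (by fun_prop)]
    conv_lhs => rw [← withDensity_one (μ := γ)]
    refine withDensity_mono (ae_of_all _ fun p => ?_)
    simp only [Pi.one_apply, Pi.smul_apply, smul_eq_mul]
    rw [← ENNReal.ofReal_ofNat, ← ENNReal.ofReal_mul (by norm_num), ENNReal.one_le_ofReal]
    linarith [h1 p]
  refine hle.trans ?_
  rw [splitMeasure, smul_add]
  exact Measure.le_add_right le_rfl

end Split

/-! ### The value of a perturbed plan -/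

section FirstOrder

variable {Ω ι : Type*} {m : MeasurableSpace Ω} [mΩ : MeasurableSpace Ω] [Fintype ι]
  {P : Measure Ω} {X Y : Ω → EuclideanSpace ℝ ι} {S : Matrix ι ι ℝ}

theorem integral_inner_condExp [IsFiniteMeasure P] (hm : m ≤ mΩ)
    (hXm : AEStronglyMeasurable[m] X P) (hX : MemLp X 2 P) (hY : MemLp Y 2 P) :
    ∫ ω, ⟪X ω, P[Y | m] ω⟫ ∂P = ∫ ω, ⟪X ω, Y ω⟫ ∂P := by
  rw [← integral_condExp hm (f := fun ω => ⟪X ω, Y ω⟫)]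
  exact integral_congr_ae (condExp_bilin_of_aestronglyMeasurable_left (innerSL ℝ) hXm
    (memLp_one_iff_integrable.1 ((innerSL ℝ).memLp_of_bilin (p := 2) (q := 2) 1 hX hY))
    (hY.integrable one_le_two)).symm

theorem integrable_inner (hX : MemLp X 2 P) (hY : MemLp Y 2 P) :
    Integrable (fun ω => ⟪X ω, Y ω⟫) P :=
  memLp_one_iff_integrable.1 ((innerSL ℝ).memLp_of_bilin (p := 2) (q := 2) 1 hX hY)

theorem integral_gain_condExp [IsFiniteMeasure P] (hm : m ≤ mΩ)
    (hXm : AEStronglyMeasurable[m] X P) (hX : MemLp X 2 P) (hY : MemLp Y 2 P) :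
    ∫ ω, gain S (X ω) (P[Y | m] ω) ∂P = ∫ ω, gain S (X ω) (Y ω) ∂P := by
  have hC : MemLp (P[Y | m]) 2 P := hY.condExp one_le_two
  unfold gain
  rw [integral_sub (integrable_sForm S hX hY) ((integrable_sForm S hX hX).const_mul _),
    integral_sub (integrable_sForm S hX hC) ((integrable_sForm S hX hX).const_mul _),
    integral_sForm_condExp hm hXm hX hY]

/-- Replacing `X` by the conditional expectation of `Y` costs at most a multiple of the squared
distance between the two. -/
theorem integral_gain_le_condExp [IsFiniteMeasure P] (hS : S.IsSymm) (hm : m ≤ mΩ)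
    (hXm : AEStronglyMeasurable[m] X P) (hX : MemLp X 2 P) (hY : MemLp Y 2 P) :
    ∫ ω, gain S (X ω) (Y ω) ∂P - 1 / 2 * ‖sFormL S‖ * ∫ ω, ‖P[Y | m] ω - X ω‖ ^ 2 ∂P
      ≤ 1 / 2 * ∫ ω, sForm S (P[Y | m] ω) (P[Y | m] ω) ∂P := by
  have hC : MemLp (P[Y | m]) 2 P := hY.condExp one_le_two
  have hD : Integrable (fun ω => ‖P[Y | m] ω - X ω‖ ^ 2) P :=
    (hC.sub hX).integrable_norm_pow two_ne_zero
  rw [← integral_gain_condExp hm hXm hX hY, ← integral_const_mul,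
    ← integral_const_mul, ← integral_sub (integrable_gain S hX hC)
    (hD.const_mul _)]
  refine integral_mono ((integrable_gain S hX hC).sub
    (hD.const_mul _)) ((integrable_sForm S hC hC).const_mul _)
    fun ω => ?_
  have h2 := neg_norm_sq_le_sForm S (P[Y | m] ω - X ω)
  have h3 := sForm_sub_self hS (P[Y | m] ω) (X ω)
  rw [sForm_comm hS (P[Y | m] ω) (X ω)] at h3
  simp only [gain]
  nlinarith

variable {γ : Measure (EuclideanSpace ℝ ι × EuclideanSpace ℝ ι)}
  {ν : Measure (EuclideanSpace ℝ ι)}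

/-- After a fraction `g ≤ δ` of the mass of a backward plan has been moved to its barycenter `z` in
`y`, the conditional mean of `y` given `x` differs from `x` by a quantity of order `δ` in `L²`, so
that the martingale property is restored at a cost of order `δ²`. -/
theorem integral_norm_condExp_sub_sq_le (hγ : IsBackwardPlan ν γ)
    {g : EuclideanSpace ℝ ι × EuclideanSpace ℝ ι → ℝ} (hg : Measurable g) (h0 : ∀ p, 0 ≤ g p)
    (h1 : ∀ p, g p ≤ 1 / 2) {δ : ℝ} (hδ : ∀ p, g p ≤ δ) (z : EuclideanSpace ℝ ι)
    (hz : ∫ p, g p • (p.2 - z) ∂γ = 0) :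
    ∫ p, ‖(splitMeasure γ g z)[Prod.snd | MeasurableSpace.comap Prod.fst inferInstance] p
        - p.1‖ ^ 2 ∂(splitMeasure γ g z) ≤ 2 * δ ^ 2 * ∫ p, ‖p.2 - p.1‖ ^ 2 ∂γ := by
  have := hγ.isProb
  have hρ := isProbabilityMeasure_splitMeasure (γ := γ) hg h0 h1 z
  set ρ := splitMeasure γ g z with hρdef
  have hle : MeasurableSpace.comap (Prod.fst : EuclideanSpace ℝ ι × EuclideanSpace ℝ ι → _)
      inferInstance ≤ Prod.instMeasurableSpace := measurable_fst.comap_le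
  have hfst : MemLp Prod.fst 2 ρ := memLp_splitMeasure h0 h1 z measurable_fst hγ.memLp_fst
    (memLp_const z)
  have hsnd : MemLp Prod.snd 2 ρ := memLp_splitMeasure h0 h1 z measurable_snd hγ.memLp_snd
    hγ.memLp_snd
  have hC : MemLp (ρ[Prod.snd | MeasurableSpace.comap Prod.fst inferInstance]) 2 ρ :=
    hsnd.condExp one_le_two
  have hfst𝒢 : StronglyMeasurable[MeasurableSpace.comap Prod.fst inferInstance]
      (Prod.fst : EuclideanSpace ℝ ι × EuclideanSpace ℝ ι → _) :=
    (comap_measurable Prod.fst).stronglyMeasurable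
  have hD𝒢 : StronglyMeasurable[MeasurableSpace.comap Prod.fst inferInstance]
      fun p => (ρ[Prod.snd | MeasurableSpace.comap Prod.fst inferInstance]) p - p.1 :=
    stronglyMeasurable_condExp.sub hfst𝒢
  obtain ⟨d, hdm, hd⟩ := hD𝒢.exists_eq_measurable_comp
  have hd' : ∀ p : EuclideanSpace ℝ ι × EuclideanSpace ℝ ι,
      (ρ[Prod.snd | MeasurableSpace.comap Prod.fst inferInstance]) p - p.1 = d p.1 :=
    fun p => congrFun hd p
  simp only [hd']
  have hdρ : MemLp (fun p : EuclideanSpace ℝ ι × EuclideanSpace ℝ ι => d p.1) 2 ρ :=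
    (memLp_congr_ae (ae_of_all _ hd')).1 (hC.sub hfst)
  have hdγ : MemLp (fun p : EuclideanSpace ℝ ι × EuclideanSpace ℝ ι => d p.1) 2 γ :=
    hdρ.of_measure_le_smul (by simp) (le_two_smul_splitMeasure hg h1 z)
  have hdm1 : Measurable fun p : EuclideanSpace ℝ ι × EuclideanSpace ℝ ι => d p.1 :=
    hdm.measurable.comp measurable_fst
  have hYX : MemLp (fun p : EuclideanSpace ℝ ι × EuclideanSpace ℝ ι => p.2 - p.1) 2 γ :=
    hγ.memLp_snd.sub hγ.memLp_fst
  have hYz : MemLp (fun p : EuclideanSpace ℝ ι × EuclideanSpace ℝ ι => p.2 - z) 2 γ :=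
    hγ.memLp_snd.sub (memLp_const z)
  have hd𝒢 : StronglyMeasurable[MeasurableSpace.comap Prod.fst inferInstance]
      fun p : EuclideanSpace ℝ ι × EuclideanSpace ℝ ι => d p.1 := by
    have : (fun p => (ρ[Prod.snd | MeasurableSpace.comap Prod.fst inferInstance]) p - p.1)
        = fun p => d p.1 := hd
    rwa [this] at hD𝒢
  have hgb : ∀ p, ‖g p‖ ≤ 1 / 2 := fun p => by
    rw [Real.norm_eq_abs, abs_of_nonneg (h0 p)]; exact h1 p
  -- the defining property of `ρ[y | x]` and the martingale property of `γ`, tested against `d(x)`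
  have e1 : ∫ p, ‖d p.1‖ ^ 2 ∂ρ = ∫ p, ⟪d p.1, p.2 - p.1⟫ ∂ρ := by
    have h := integral_inner_condExp hle hd𝒢.aestronglyMeasurable hdρ hsnd
    have h' : ∫ p, ‖d p.1‖ ^ 2 ∂ρ
        = ∫ p, (⟪d p.1, (ρ[Prod.snd | MeasurableSpace.comap Prod.fst inferInstance]) p⟫
          - ⟪d p.1, p.1⟫) ∂ρ := by
      refine integral_congr_ae (ae_of_all _ fun p => ?_)
      simp only
      rw [← inner_sub_right, hd', real_inner_self_eq_norm_sq]
    rw [h', integral_sub (integrable_inner hdρ hC) (integrable_inner hdρ hfst), h,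
      ← integral_sub (integrable_inner hdρ hsnd) (integrable_inner hdρ hfst)]
    simp only [inner_sub_right]
  have e2 : ∫ p, ⟪d p.1, p.2 - p.1⟫ ∂γ = 0 := by
    have h := integral_inner_condExp hle hd𝒢.aestronglyMeasurable hdγ hγ.memLp_snd
    simp only [inner_sub_right]
    rw [integral_sub (integrable_inner hdγ hγ.memLp_snd) (integrable_inner hdγ hγ.memLp_fst),
      ← h, sub_eq_zero]
    exact integral_congr_ae (hγ.martingale.mono fun p hp => by
      simp only; rw [hp])
  have e3 : ∫ p, g p * ⟪d z, p.2 - z⟫ ∂γ = 0 := by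
    have : ∀ p : EuclideanSpace ℝ ι × EuclideanSpace ℝ ι,
        g p * ⟪d z, p.2 - z⟫ = ⟪d z, g p • (p.2 - z)⟫ := fun p => by
      rw [real_inner_smul_right]
    simp only [this]
    have hi : Integrable (fun p => g p • (p.2 - z)) γ :=
      (hYz.integrable one_le_two).bdd_smul (1 / 2) hg.aestronglyMeasurable (ae_of_all _ hgb)
    rw [integral_inner hi, hz, inner_zero_right]
  have i1 := integrable_inner hdγ hYX
  have i2 : Integrable (fun p => g p * ⟪d p.1, p.2 - p.1⟫) γ :=
    i1.bdd_mul hg.aestronglyMeasurable (ae_of_all _ hgb)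
  have e4 : ∫ p, ⟪d p.1, p.2 - p.1⟫ ∂ρ = -∫ p, g p * ⟪d p.1, p.2 - p.1⟫ ∂γ := by
    rw [hρdef, integral_splitMeasure hg h0 h1 z (f := fun p => ⟪d p.1, p.2 - p.1⟫)
      (by fun_prop) i1 (integrable_inner (memLp_const (d z)) hYz), e3, add_zero]
    simp only [sub_mul, one_mul]
    rw [integral_sub i1 i2, e2, zero_sub]
  have i3 : Integrable (fun p : EuclideanSpace ℝ ι × EuclideanSpace ℝ ι => ‖d p.1‖ ^ 2) γ :=
    hdγ.integrable_norm_pow two_ne_zero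
  have i4 : Integrable (fun p : EuclideanSpace ℝ ι × EuclideanSpace ℝ ι => ‖p.2 - p.1‖ ^ 2) γ :=
    hYX.integrable_norm_pow two_ne_zero
  have e5 : -∫ p, g p * ⟪d p.1, p.2 - p.1⟫ ∂γ
      ≤ 1 / 4 * ∫ p, ‖d p.1‖ ^ 2 ∂γ + δ ^ 2 * ∫ p, ‖p.2 - p.1‖ ^ 2 ∂γ := by
    rw [← integral_neg, ← integral_const_mul, ← integral_const_mul,
      ← integral_add (i3.const_mul _) (i4.const_mul _)]
    refine integral_mono i2.neg ((i3.const_mul _).add (i4.const_mul _)) fun p => ?_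
    have hin := abs_real_inner_le_norm (d p.1) (p.2 - p.1)
    have h2 : -(g p * ⟪d p.1, p.2 - p.1⟫) ≤ δ * (‖d p.1‖ * ‖p.2 - p.1‖) := by
      calc -(g p * ⟪d p.1, p.2 - p.1⟫) = g p * -⟪d p.1, p.2 - p.1⟫ := by ring
        _ ≤ g p * (‖d p.1‖ * ‖p.2 - p.1‖) :=
          mul_le_mul_of_nonneg_left ((neg_le_abs _).trans hin) (h0 p)
        _ ≤ _ := mul_le_mul_of_nonneg_right (hδ p) (by positivity)
    -- Young's inequality, with half of `∫ ‖d‖² dρ` left over after `γ ≤ 2 ρ`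
    have h3 := sq_nonneg (1 / 2 * ‖d p.1‖ - δ * ‖p.2 - p.1‖)
    simp only
    nlinarith
  have e6 : ∫ p, ‖d p.1‖ ^ 2 ∂γ ≤ 2 * ∫ p, ‖d p.1‖ ^ 2 ∂ρ := by
    have h := integral_mono_measure (le_two_smul_splitMeasure (γ := γ) hg h1 z)
      (ae_of_all _ fun p => by positivity)
      ((hdρ.integrable_norm_pow two_ne_zero).smul_measure (by simp))
    rw [integral_smul_measure] at h
    simpa using h
  linarith [e1, e4, e5, e6]

end FirstOrder

/-! ### Absence of a duality gap for optimal plans -/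

section StrongDuality

variable {ι : Type*} [Fintype ι] {S : Matrix ι ι ℝ}
  {γ : Measure (EuclideanSpace ℝ ι × EuclideanSpace ℝ ι)} {ν : Measure (EuclideanSpace ℝ ι)}

/-- First-order optimality condition for a plan: no part `h γ` of the plan is improved by
transporting it to its barycenter in `y`. -/
theorem half_sForm_barycenter_le (hS : S.IsSymm) (hγ : IsOptimalPlan S ν γ)
    {h : EuclideanSpace ℝ ι × EuclideanSpace ℝ ι → ℝ} (hh : Measurable h) (h0 : ∀ p, 0 ≤ h p)
    {C : ℝ} (hC : ∀ p, h p ≤ C) (h1 : ∫ p, h p ∂γ = 1) :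
    1 / 2 * sForm S (∫ p, h p • p.2 ∂γ) (∫ p, h p • p.2 ∂γ)
      ≤ ∫ p, h p * gain S p.1 p.2 ∂γ := by
  have := hγ.1.isProb
  have hC0 : 0 ≤ C := (h0 0).trans (hC 0)
  have hX := hγ.1.memLp_fst
  have hY := hγ.1.memLp_snd
  have hb : ∀ p, ‖h p‖ ≤ C := fun p => by
    rw [Real.norm_eq_abs, abs_of_nonneg (h0 p)]; exact hC p
  have hhi : Integrable h γ := by
    simpa using (integrable_const (1 : ℝ) (μ := γ)).bdd_mul hh.aestronglyMeasurable
      (ae_of_all _ hb)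
  have hhY : Integrable (fun p => h p • p.2) γ :=
    (hY.integrable one_le_two).bdd_smul C hh.aestronglyMeasurable (ae_of_all _ hb)
  have hg := integrable_gain S hX hY
  have hhg : Integrable (fun p => h p * gain S p.1 p.2) γ :=
    hg.bdd_mul hh.aestronglyMeasurable (ae_of_all _ hb)
  set z := ∫ p, h p • p.2 ∂γ with hz
  set B := ∫ p, ‖p.2 - p.1‖ ^ 2 ∂γ with hB
  have hB0 : 0 ≤ B := integral_nonneg fun p => by positivity
  have hzg := integrable_gain S (P := γ) (memLp_const z) hY
  have ez : ∫ p, h p * gain S z p.2 ∂γ = 1 / 2 * sForm S z z := by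
    have e : ∀ p : EuclideanSpace ℝ ι × EuclideanSpace ℝ ι, h p * gain S z p.2
        = sFormL S z (h p • p.2) - h p * (1 / 2 * sForm S z z) := fun p => by
      rw [map_smul, sFormL_apply, gain, smul_eq_mul]; ring
    simp only [e]
    rw [integral_sub ((sFormL S z).integrable_comp hhY) (hhi.mul_const _),
      ContinuousLinearMap.integral_comp_comm _ hhY, integral_mul_const, h1, ← hz, sFormL_apply]
    ring
  -- the plan in which the fraction `ε h` of `γ` is moved to `z`
  have key : ∀ ε > 0, ε * C ≤ 1 / 2 →
      1 / 2 * sForm S z z ≤ ∫ p, h p * gain S p.1 p.2 ∂γ + ε * (‖sFormL S‖ * C ^ 2 * B) := by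
    intro ε hε hεC
    have g0 : ∀ p, 0 ≤ ε * h p := fun p => mul_nonneg hε.le (h0 p)
    have gδ : ∀ p, ε * h p ≤ ε * C := fun p => mul_le_mul_of_nonneg_left (hC p) hε.le
    have g1 : ∀ p, ε * h p ≤ 1 / 2 := fun p => (gδ p).trans hεC
    have hgm : Measurable fun p => ε * h p := hh.const_mul ε
    have hzero : ∫ p, (ε * h p) • (p.2 - z) ∂γ = 0 := by
      simp only [mul_smul, smul_sub]
      have i1 : Integrable (fun p => ε • h p • p.2) γ := hhY.smul ε
      have i2 : Integrable (fun p => ε • h p • z) γ := (hhi.smul_const z).smul ε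
      rw [integral_sub i1 i2, integral_smul, integral_smul,
        integral_smul_const, h1, one_smul, sub_self]
    have hI := integral_norm_condExp_sub_sq_le hγ.1 hgm g0 g1 gδ z hzero
    have hsplit := integral_splitMeasure hgm g0 g1 z (f := fun p => gain S p.1 p.2)
      (by fun_prop) hg hzg
    have hρ := isProbabilityMeasure_splitMeasure (γ := γ) hgm g0 g1 z
    have hρsnd := map_snd_splitMeasure (γ := γ) hgm g0 g1 z
    have hX' : MemLp Prod.fst 2 (splitMeasure γ (fun p => ε * h p) z) :=
      memLp_splitMeasure g0 g1 z measurable_fst hX (memLp_const z)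
    have hY' : MemLp Prod.snd 2 (splitMeasure γ (fun p => ε * h p) z) :=
      memLp_splitMeasure g0 g1 z measurable_snd hY hY
    set ρ := splitMeasure γ (fun p => ε * h p) z with hρdef
    have hle : MeasurableSpace.comap (Prod.fst : EuclideanSpace ℝ ι × EuclideanSpace ℝ ι → _)
      inferInstance ≤ Prod.instMeasurableSpace := measurable_fst.comap_le
    have hgain := integral_gain_le_condExp hS hle
      (comap_measurable Prod.fst).stronglyMeasurable.aestronglyMeasurable hX' hY'
    -- conditioning `y` on the new first coordinate restores the martingale property
    set X' := ρ[Prod.snd | MeasurableSpace.comap Prod.fst inferInstance] with hX'def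
    have hX'm : Measurable[MeasurableSpace.comap Prod.fst inferInstance] X' :=
      stronglyMeasurable_condExp.measurable
    have hX'2 : MemLp X' 2 ρ := hY'.condExp one_le_two
    have hmart : ρ[Prod.snd | MeasurableSpace.comap X' inferInstance] =ᵐ[ρ] X' :=
      condExp_comap_eq_self hle hX'm (Filter.EventuallyEq.refl _ _) (hX'2.integrable one_le_two)
    have hplan := isBackwardPlan_map (hX'm.mono hle le_rfl) hX'2 measurable_snd hY' hmart
    rw [hρsnd, hγ.1.marginal] at hplan
    have hopt := hγ.2 _ hplan
    rw [integral_map ((hX'm.mono hle le_rfl).prodMk measurable_snd).aemeasurable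
      (Continuous.aestronglyMeasurable (by fun_prop)),
      ← integral_sForm_self_eq (hX'm.mono hle le_rfl) hX'2 hY' hmart,
      ← integral_gain_eq measurable_fst hX hY hγ.1.martingale] at hopt
    have e1 : ∫ p, (1 - ε * h p) * gain S p.1 p.2 ∂γ
        = ∫ p, gain S p.1 p.2 ∂γ - ε * ∫ p, h p * gain S p.1 p.2 ∂γ := by
      rw [← integral_const_mul, ← integral_sub hg (hhg.const_mul ε)]
      congr 1; ext p; ring
    have e2 : ∫ p, ε * h p * gain S z p.2 ∂γ = ε * (1 / 2 * sForm S z z) := by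
      rw [← ez, ← integral_const_mul]
      congr 1; ext p; ring
    rw [e1, e2] at hsplit
    rw [hsplit] at hgain
    have hI' := mul_le_mul_of_nonneg_left hI
      (by positivity : 0 ≤ 1 / 2 * ‖sFormL S‖)
    have : ε * (1 / 2 * sForm S z z)
        ≤ ε * (∫ p, h p * gain S p.1 p.2 ∂γ + ε * (‖sFormL S‖ * C ^ 2 * B)) := by
      nlinarith
    exact le_of_mul_le_mul_left this hε
  have hK : 0 ≤ ‖sFormL S‖ * C ^ 2 * B := by positivity
  refine le_of_forall_pos_le_add fun η hη => ?_
  set K := ‖sFormL S‖ * C ^ 2 * B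
  set ε := min (1 / (2 * (C + 1))) (η / (K + 1)) with hε
  have hε0 : 0 < ε := lt_min (by positivity) (by positivity)
  have hεC : ε * C ≤ 1 / 2 := by
    calc ε * C ≤ 1 / (2 * (C + 1)) * C := mul_le_mul_of_nonneg_right (min_le_left _ _) hC0
      _ ≤ 1 / 2 := by
        rw [div_mul_eq_mul_div, div_le_div_iff₀ (by positivity) (by norm_num)]; linarith
  have hεK : ε * K ≤ η := by
    calc ε * K ≤ η / (K + 1) * K := mul_le_mul_of_nonneg_right (min_le_right _ _) hK
      _ ≤ η := by
        rw [div_mul_eq_mul_div, div_le_iff₀ (by positivity)]; nlinarith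
  linarith [key ε hε0 hεC]

/-- The points `(∫ h y dγ, ∫ h (S(x, y) - ½ S(x, x)) dγ)` for bounded probability densities `h`
with respect to `γ`. -/
def barycenters (S : Matrix ι ι ℝ) (γ : Measure (EuclideanSpace ℝ ι × EuclideanSpace ℝ ι)) :
    Set (EuclideanSpace ℝ ι × ℝ) :=
  {k | ∃ h : EuclideanSpace ℝ ι × EuclideanSpace ℝ ι → ℝ, Measurable h ∧ (∀ p, 0 ≤ h p) ∧
    (∃ C, ∀ p, h p ≤ C) ∧ ∫ p, h p ∂γ = 1 ∧
    k = (∫ p, h p • p.2 ∂γ, ∫ p, h p * gain S p.1 p.2 ∂γ)}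

theorem convex_barycenters (hγ : IsBackwardPlan ν γ) : Convex ℝ (barycenters S γ) := by
  have := hγ.isProb
  have hi : ∀ h : EuclideanSpace ℝ ι × EuclideanSpace ℝ ι → ℝ, Measurable h → (∀ p, 0 ≤ h p) →
      ∀ C, (∀ p, h p ≤ C) → Integrable h γ ∧ Integrable (fun p => h p • p.2) γ ∧
        Integrable (fun p => h p * gain S p.1 p.2) γ := by
    intro h hh h0 C hC
    have hb : ∀ᵐ p ∂γ, ‖h p‖ ≤ C := ae_of_all _ fun p => by
      rw [Real.norm_eq_abs, abs_of_nonneg (h0 p)]; exact hC p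
    exact ⟨by simpa using (integrable_const (1 : ℝ) (μ := γ)).bdd_mul hh.aestronglyMeasurable hb,
      (hγ.memLp_snd.integrable one_le_two).bdd_smul C hh.aestronglyMeasurable hb,
      (integrable_gain S hγ.memLp_fst hγ.memLp_snd).bdd_mul hh.aestronglyMeasurable hb⟩
  rintro _ ⟨h, hh, h0, ⟨C, hC⟩, h1, rfl⟩ _ ⟨h', hh', h0', ⟨C', hC'⟩, h1', rfl⟩ s t hs ht hst
  obtain ⟨i1, i2, i3⟩ := hi h hh h0 C hC
  obtain ⟨i1', i2', i3'⟩ := hi h' hh' h0' C' hC'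
  refine ⟨fun p => s * h p + t * h' p, by fun_prop,
    fun p => add_nonneg (mul_nonneg hs (h0 p)) (mul_nonneg ht (h0' p)),
    ⟨s * C + t * C', fun p => add_le_add (mul_le_mul_of_nonneg_left (hC p) hs)
      (mul_le_mul_of_nonneg_left (hC' p) ht)⟩, ?_, ?_⟩
  · rw [integral_add (i1.const_mul s) (i1'.const_mul t), integral_const_mul, integral_const_mul,
      h1, h1']
    linarith
  · simp only [add_smul, mul_smul, add_mul, mul_assoc]
    have j2 : Integrable (fun p => s • h p • p.2) γ := i2.smul s
    have j2' : Integrable (fun p => t • h' p • p.2) γ := i2'.smul t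
    rw [integral_add j2 j2', integral_smul, integral_smul,
      integral_add (i3.const_mul s) (i3'.const_mul t), integral_const_mul, integral_const_mul]
    rfl

theorem barycenters_nonempty [IsProbabilityMeasure γ] : (barycenters S γ).Nonempty :=
  ⟨_, fun _ => 1, measurable_const, fun _ => zero_le_one, ⟨1, fun _ => le_rfl⟩, by simp, rfl⟩

theorem integral_indicator_const_smul {α W : Type*} [MeasurableSpace α] {μ : Measure α}
    [NormedAddCommGroup W] [NormedSpace ℝ W] {A : Set α} (hA : MeasurableSet A) (c : ℝ)
    (f : α → W) : ∫ p, A.indicator (fun _ => c) p • f p ∂μ = c • ∫ p in A, f p ∂μ := by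
  rw [← integral_smul, ← integral_indicator hA]
  congr 1; ext p
  by_cases hp : p ∈ A <;> simp [hp]

/-- An affine function `S(a, ·) - ½ S(a, a)` that stays below the barycenters of `γ` is dominated
by `S(x, y) - ½ S(x, x)` almost surely. -/
theorem ae_gain_le_of_barycenters (hγ : IsBackwardPlan ν γ) {a : EuclideanSpace ℝ ι}
    (ha : ∀ k ∈ barycenters S γ, gain S a k.1 ≤ k.2) :
    ∀ᵐ p ∂γ, gain S a p.2 ≤ gain S p.1 p.2 := by
  have := hγ.isProb
  have hg := integrable_gain S hγ.memLp_fst hγ.memLp_snd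
  have hag := integrable_gain S (P := γ) (memLp_const a) hγ.memLp_snd
  have hYi := hγ.memLp_snd.integrable one_le_two
  have key : 0 ≤ᵐ[γ] fun p => gain S p.1 p.2 - gain S a p.2 := by
    refine ae_nonneg_of_forall_setIntegral_nonneg (hg.sub hag) fun A hA _ => ?_
    rcases eq_or_ne (γ.real A) 0 with hA0 | hA0
    · have : γ A = 0 := (measureReal_eq_zero_iff).1 hA0
      rw [setIntegral_measure_zero _ this]
    have hApos : 0 < γ.real A := lt_of_le_of_ne measureReal_nonneg hA0.symm
    set c := (γ.real A)⁻¹ with hc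
    have hcpos : 0 < c := inv_pos.2 hApos
    -- the barycenter of the normalized restriction of `γ` to `A`
    have hk := ha _ ⟨A.indicator fun _ => c, measurable_const.indicator hA,
      fun p => Set.indicator_nonneg (fun _ _ => hcpos.le) p,
      ⟨c, fun p => Set.indicator_le_self' (fun _ _ => hcpos.le) p⟩, by
        rw [integral_indicator hA, setIntegral_const, smul_eq_mul, hc, mul_inv_cancel₀ hA0], rfl⟩
    simp only [← smul_eq_mul (a := A.indicator (fun _ => c) _)] at hk
    rw [integral_indicator_const_smul hA, integral_indicator_const_smul hA, gain,
      sForm_smul_right, smul_eq_mul] at hk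
    have e1 : sForm S a (∫ p in A, p.2 ∂γ) = ∫ p in A, sForm S a p.2 ∂γ := by
      simp only [← sFormL_apply]
      exact (ContinuousLinearMap.integral_comp_comm _ hYi.integrableOn).symm
    have e2 : ∫ p in A, gain S a p.2 ∂γ
        = ∫ p in A, sForm S a p.2 ∂γ - γ.real A * (1 / 2 * sForm S a a) := by
      unfold gain
      rw [integral_sub (integrable_sForm S (memLp_const a) hγ.memLp_snd).integrableOn
        (integrable_const _), setIntegral_const, smul_eq_mul]
    rw [integral_sub hg.integrableOn hag.integrableOn, e2, ← e1, sub_nonneg]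
    have hcA : c * γ.real A = 1 := inv_mul_cancel₀ hA0
    refine le_of_mul_le_mul_left ?_ hcpos
    calc c * (sForm S a (∫ p in A, p.2 ∂γ) - γ.real A * (1 / 2 * sForm S a a))
        = c * sForm S a (∫ p in A, p.2 ∂γ) - c * γ.real A * (1 / 2 * sForm S a a) := by ring
      _ ≤ _ := by rw [hcA, one_mul]; exact hk
  filter_upwards [key] with p hp
  simpa using hp

/-- Absence of a duality gap: the value of an optimal plan is attained by some maximal monotone
set in the dual problem. -/
theorem exists_isMaxSMonotone_of_isOptimalPlan {m : ℕ}
    {ν : Measure (EuclideanSpace ℝ (Fin m ⊕ Fin m))}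
    {γ : Measure (EuclideanSpace ℝ (Fin m ⊕ Fin m) × EuclideanSpace ℝ (Fin m ⊕ Fin m))}
    (hγ : IsOptimalPlan (stdMatrix m) ν γ) :
    ∃ H, IsMaxSMonotone (stdMatrix m) H ∧ extIntegral ν (fitzpatrick (stdMatrix m) H)
      ≤ ((1 / 2 * ∫ p, sForm (stdMatrix m) p.1 p.2 ∂γ : ℝ) : EReal) := by
  have := hγ.1.isProb
  obtain ⟨H, hH, hHK⟩ := exists_isMaxSMonotone_gain_le (convex_barycenters hγ.1)
    barycenters_nonempty (by
      rintro _ ⟨h, hh, h0, ⟨C, hC⟩, h1, rfl⟩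
      exact half_sForm_barycenter_le isSymm_stdMatrix hγ hh h0 hC h1)
  refine ⟨H, hH, ?_⟩
  rw [← integral_gain_eq measurable_fst hγ.1.memLp_fst hγ.1.memLp_snd hγ.1.martingale,
    ← hγ.1.marginal]
  refine extIntegral_fitzpatrick_le measurable_snd
    (integrable_gain _ hγ.1.memLp_fst hγ.1.memLp_snd) ?_
  exact ae_forall_mem_of_continuous (fun p => by fun_prop) (fun p => by fun_prop)
    fun a ha => ae_gain_le_of_barycenters hγ.1 (hHK a ha)

end StrongDuality

/-! ### Borel selections and equilibria -/

section Selection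

variable {E F : Type*} [PseudoMetricSpace E] [NormedAddCommGroup F] [ProperSpace F]
  {A : Set (E × F)}

theorem isClosed_setOf_exists_norm_le (hA : IsClosed A) {C : Set F} (hC : IsClosed C) (t : ℝ) :
    IsClosed {r | ∃ v ∈ C, (r, v) ∈ A ∧ ‖v‖ ≤ t} := by
  refine IsSeqClosed.isClosed fun r r₀ hr hlim => ?_
  choose v hvC hvA hvt using hr
  obtain ⟨v₀, hv₀, φ, hφ, hv⟩ := (isCompact_closedBall (0 : F) t).tendsto_subseq
    (x := v) fun n => by simpa using hvt n
  exact ⟨v₀, hC.mem_of_tendsto hv (Filter.Eventually.of_forall fun n => hvC _),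
    hA.mem_of_tendsto ((hlim.comp hφ.tendsto_atTop).prodMk_nhds hv)
      (Filter.Eventually.of_forall fun n => hvA _), by simpa using hv₀⟩

/-- A set with closed graph and nonempty convex sections has a Borel selection: the element of
minimal norm of each section. -/
theorem exists_measurable_selection [InnerProductSpace ℝ F] [MeasurableSpace E] [BorelSpace E]
    [MeasurableSpace F] [BorelSpace F] (hA : IsClosed A) (hconv : ∀ r, Convex ℝ {v | (r, v) ∈ A})
    (hne : ∀ r, ∃ v, (r, v) ∈ A) : ∃ s : E → F, Measurable s ∧ ∀ r, (r, s r) ∈ A := by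
  have hsec : ∀ r, IsClosed {v | (r, v) ∈ A} := fun r => hA.preimage (by fun_prop)
  have hmin : ∀ B : Set F, IsClosed B → B.Nonempty → ∃ v ∈ B, ∀ w ∈ B, ‖v‖ ≤ ‖w‖ := by
    intro B hB hBne
    obtain ⟨v, hv, hdist⟩ := hB.exists_infDist_eq_dist hBne 0
    refine ⟨v, hv, fun w hw => ?_⟩
    simpa [hdist] using Metric.infDist_le_dist_of_mem (x := (0 : F)) hw
  choose s hsA hsmin using fun r => hmin _ (hsec r) (hne r)
  have huniq : ∀ r v, (r, v) ∈ A → ‖v‖ ≤ ‖s r‖ → v = s r := by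
    intro r v hv hle
    have hmid := hsmin r ((1 / 2 : ℝ) • v + (1 / 2 : ℝ) • s r)
      (hconv r hv (hsA r) (by norm_num) (by norm_num) (by norm_num))
    rw [← smul_add, norm_smul, Real.norm_of_nonneg (by norm_num)] at hmid
    have hpar := parallelogram_law_with_norm ℝ v (s r)
    have h1 := norm_nonneg (s r)
    have h2 := norm_nonneg v
    rw [← sub_eq_zero, ← norm_eq_zero]
    have h3 : 2 * ‖s r‖ ≤ ‖v + s r‖ := by linarith
    nlinarith [norm_nonneg (v - s r)]
  refine ⟨s, measurable_of_isClosed fun C hC => ?_, hsA⟩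
  -- `s r ∈ C` if and only if the minimum of the norm over the section at `r` is attained in `C`
  have hpre : s ⁻¹' C = ⋂ t : ℚ, {r | ∃ v ∈ Set.univ, (r, v) ∈ A ∧ ‖v‖ ≤ (t : ℝ)}ᶜ ∪
      {r | ∃ v ∈ C, (r, v) ∈ A ∧ ‖v‖ ≤ (t : ℝ)} := by
    ext r
    simp only [Set.mem_preimage, Set.mem_iInter, Set.mem_union, Set.mem_compl_iff,
      Set.mem_ofPred_eq, ← imp_iff_not_or]
    constructor
    · rintro hr t ⟨v, -, hv, hvt⟩
      exact ⟨s r, hr, hsA r, (hsmin r v hv).trans hvt⟩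
    · intro h
      have h' : ∀ t : ℚ, ‖s r‖ < t → ∃ v ∈ C, (r, v) ∈ A ∧ ‖v‖ ≤ (t : ℝ) :=
        fun t ht => h t ⟨s r, trivial, hsA r, ht.le⟩
      obtain ⟨t₀, ht₀⟩ := exists_rat_gt ‖s r‖
      obtain ⟨v₀, hv₀C, hv₀A, -⟩ := h' t₀ ht₀
      obtain ⟨v, ⟨hvC, hvA⟩, hv⟩ := hmin (C ∩ {v | (r, v) ∈ A}) (hC.inter (hsec r))
        ⟨v₀, hv₀C, hv₀A⟩
      have hvs : ‖v‖ ≤ ‖s r‖ := by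
        by_contra! hlt
        obtain ⟨t, ht1, ht2⟩ := exists_rat_btwn hlt
        obtain ⟨w, hwC, hwA, hwt⟩ := h' t ht1
        linarith [hv w ⟨hwC, hwA⟩]
      rwa [← huniq r v hvA hvs]
  rw [hpre]
  exact MeasurableSet.iInter fun t =>
    (isClosed_setOf_exists_norm_le hA isClosed_univ t).measurableSet.compl.union
      (isClosed_setOf_exists_norm_le hA hC t).measurableSet

variable {m : ℕ} {G : Set (EuclideanSpace ℝ (Fin m ⊕ Fin m))}

theorem IsMaxSMonotone.exists_measurable_selection (hG : IsMaxSMonotone (stdMatrix m) G)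
    (hproj : projFst G = Set.univ) :
    ∃ s : EuclideanSpace ℝ (Fin m) → EuclideanSpace ℝ (Fin m),
      Measurable s ∧ ∀ r, pair r (s r) ∈ G := by
  refine BackwardTransport.exists_measurable_selection
    (A := {p : EuclideanSpace ℝ (Fin m) × EuclideanSpace ℝ (Fin m) | pair p.1 p.2 ∈ G})
    ((hG.isClosed isSymm_stdMatrix).preimage continuous_pair) (fun r => ?_) fun r => ?_
  · intro v hv w hw s t hs ht hst
    refine (hG.mem_iff isSymm_stdMatrix).2 ?_
    replace hv := (hG.mem_iff isSymm_stdMatrix).1 hv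
    replace hw := (hG.mem_iff isSymm_stdMatrix).1 hw
    intro b hb
    have h1 := hv b hb
    have h2 := hw b hb
    rw [← pair_fstL_sndL b] at h1 h2 ⊢
    rw [← gain_self, gain_pair, gain_pair] at h1 h2 ⊢
    rw [sub_self, inner_zero_left, zero_add, inner_sub_right] at h1 h2 ⊢
    simp only [inner_add_right, real_inner_smul_right]
    obtain rfl : s = 1 - t := by linarith
    nlinarith [mul_le_mul_of_nonneg_left h1 hs, mul_le_mul_of_nonneg_left h2 ht]
  · have : r ∈ projFst G := hproj ▸ Set.mem_univ r
    exact this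

end Selection

section Equilibrium

variable {Ω : Type*} {n : MeasurableSpace Ω} [mΩ : MeasurableSpace Ω] {P : Measure Ω} {m : ℕ}
  {U V R : Ω → EuclideanSpace ℝ (Fin m)}
  {f : EuclideanSpace ℝ (Fin m) → EuclideanSpace ℝ (Fin m)}
  {G : Set (EuclideanSpace ℝ (Fin m ⊕ Fin m))}

theorem measurable_pair (hU : Measurable U) (hV : Measurable V) :
    Measurable fun ω => pair (U ω) (V ω) :=
  continuous_pair.measurable.comp (hU.prodMk hV)

theorem norm_pair_le (u v : EuclideanSpace ℝ (Fin m)) : ‖pair u v‖ ≤ ‖u‖ + ‖v‖ := by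
  have h : ‖pair u v‖ ^ 2 = ‖u‖ ^ 2 + ‖v‖ ^ 2 := by
    simp [EuclideanSpace.norm_sq_eq, pair, Fintype.sum_sum_type]
  refine le_of_sq_le_sq ?_ (by positivity)
  nlinarith [mul_nonneg (norm_nonneg u) (norm_nonneg v)]

theorem memLp_pair (hU : MemLp U 2 P) (hV : MemLp V 2 P) :
    MemLp (fun ω => pair (U ω) (V ω)) 2 P := by
  refine (hU.norm.add hV.norm).mono
    (continuous_pair.comp_aestronglyMeasurable (hU.1.prodMk hV.1)) (ae_of_all _ fun ω => ?_)
  exact (norm_pair_le _ _).trans (le_abs_self _)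

theorem fstL_condExp_pair (hY : Integrable (fun ω => pair (U ω) (V ω)) P) :
    ∀ᵐ ω ∂P, fstL m (P[fun ω => pair (U ω) (V ω) | n] ω) = P[U | n] ω := by
  have h := (fstL m).comp_condExp_comm (m := n) hY
  have e : (fstL m ∘ fun ω => pair (U ω) (V ω)) = U := by ext1 ω; simp
  rw [e] at h
  exact h

theorem sndL_condExp_pair (hY : Integrable (fun ω => pair (U ω) (V ω)) P) :
    ∀ᵐ ω ∂P, sndL m (P[fun ω => pair (U ω) (V ω) | n] ω) = P[V | n] ω := by
  have h := (sndL m).comp_condExp_comm (m := n) hY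
  have e : (sndL m ∘ fun ω => pair (U ω) (V ω)) = V := by ext1 ω; simp
  rw [e] at h
  exact h

/-- The Fitzpatrick function of the graph of an everywhere defined map `f` does not increase when
the graph is enlarged to a monotone set `G`. -/
theorem gain_le_of_graph_subset (hG : IsSMonotone (stdMatrix m) G) (hfG : ∀ r, pair r (f r) ∈ G)
    {y : EuclideanSpace ℝ (Fin m ⊕ Fin m)} {T : ℝ}
    (hT : ∀ r, gain (stdMatrix m) (pair r (f r)) y ≤ T) {a : EuclideanSpace ℝ (Fin m ⊕ Fin m)}
    (ha : a ∈ G) : gain (stdMatrix m) a y ≤ T := by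
  rw [← pair_fstL_sndL a] at ha ⊢
  rw [← pair_fstL_sndL y] at hT ⊢
  simp only [gain_pair] at hT ⊢
  set r := fstL m a
  set s := sndL m a
  set u := fstL m y
  set v := sndL m y
  -- the graph is evaluated at points of the segment from `r` to `u` that tend to `r`
  have key : ∀ ε : ℝ, 0 < ε → ε ≤ 1 → (1 - ε) * ⟪r - u, v - s⟫ + ⟪u, v⟫ ≤ T := by
    intro ε hε hε1
    have hmono := hG _ (hfG (r + ε • (u - r))) _ ha
    rw [sForm_stdMatrix] at hmono
    simp only [map_sub, fstL_pair, sndL_pair, add_sub_cancel_left] at hmono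
    rw [real_inner_comm, ← two_mul, real_inner_smul_left] at hmono
    have hm : 0 ≤ ⟪u - r, f (r + ε • (u - r)) - s⟫ := by
      by_contra! hneg
      nlinarith
    refine le_trans ?_ (hT (r + ε • (u - r)))
    have e1 : r + ε • (u - r) - u = (1 - ε) • (r - u) := by module
    have e2 : v - f (r + ε • (u - r)) = (v - s) - (f (r + ε • (u - r)) - s) := by abel
    rw [e1, e2, real_inner_smul_left]
    generalize f (r + ε • (u - r)) - s = d at hm ⊢
    rw [inner_sub_right _ _ d]
    rw [← neg_sub r u, inner_neg_left] at hm
    nlinarith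
  have hlim : Filter.Tendsto (fun ε : ℝ => (1 - ε) * ⟪r - u, v - s⟫ + ⟪u, v⟫)
      (nhdsWithin 0 (Set.Ioi 0)) (nhds ((1 - 0) * ⟪r - u, v - s⟫ + ⟪u, v⟫)) :=
    (Continuous.tendsto (by fun_prop) 0).mono_left nhdsWithin_le_nhds
  rw [sub_zero, one_mul] at hlim
  refine le_of_tendsto hlim ?_
  filter_upwards [Ioc_mem_nhdsGT (zero_lt_one' ℝ)] with ε hε using key ε hε.1 hε.2

variable [IsProbabilityMeasure P]

/-- An equilibrium with a monotone pricing function `f` yields a primal-dual pair without duality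
gap: the conditional expectation of `(U, V)` given the total order `R`, and a maximal monotone
extension of the graph of `f`. -/
theorem IsEquilibrium.exists_no_gap (hU : MemLp U 2 P) (hV : MemLp V 2 P)
    (hUm : Measurable U) (hVm : Measurable V)
    (hRf : IsEquilibrium P U V R f) (hf : IsMonotoneMap f) :
    ∃ X G, IsBackwardMap P (fun ω => pair (U ω) (V ω)) X ∧ IsMaxSMonotone (stdMatrix m) G ∧
      projFst G = Set.univ ∧
      extIntegral (P.map fun ω => pair (U ω) (V ω)) (fitzpatrick (stdMatrix m) G)
        ≤ ((1 / 2 * ∫ ω, sForm (stdMatrix m) (X ω) (pair (U ω) (V ω)) ∂P : ℝ) : EReal) := by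
  have hgraph : IsSMonotone (stdMatrix m) (Set.range fun r => pair r (f r)) := by
    rintro _ ⟨r, rfl⟩ _ ⟨s, rfl⟩
    rw [sForm_stdMatrix]
    simp only [map_sub, fstL_pair, sndL_pair]
    rw [real_inner_comm]
    linarith [hf r s]
  obtain ⟨G, hfG, hG⟩ := hgraph.exists_isMaxSMonotone
  have hfG' : ∀ r, pair r (f r) ∈ G := fun r => hfG ⟨r, rfl⟩
  have hY : MemLp (fun ω => pair (U ω) (V ω)) 2 P := memLp_pair hU hV
  have hYm : Measurable fun ω => pair (U ω) (V ω) := measurable_pair hUm hVm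
  have hle := hRf.measurable_order.comap_le
  have hfR : MemLp (fun ω => f (R ω)) 2 P :=
    (memLp_congr_ae hRf.efficient).2 (hV.condExp one_le_two)
  have hX₀ : MemLp (fun ω => pair (R ω) (f (R ω))) 2 P := memLp_pair hRf.memLp_order hfR
  have hX₀m : Measurable[MeasurableSpace.comap R inferInstance]
      fun ω => pair (R ω) (f (R ω)) :=
    (measurable_pair measurable_id hRf.measurable_price).comp (comap_measurable R)
  set X := P[fun ω => pair (U ω) (V ω) | MeasurableSpace.comap R inferInstance] with hX
  have hX2 : MemLp X 2 P := hY.condExp one_le_two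
  have hXm : Measurable[MeasurableSpace.comap R inferInstance] X :=
    stronglyMeasurable_condExp.measurable
  have hmart : P[fun ω => pair (U ω) (V ω) | MeasurableSpace.comap X inferInstance] =ᵐ[P] X :=
    condExp_comap_eq_self hle hXm (Filter.EventuallyEq.refl _ _) (hX2.integrable one_le_two)
  refine ⟨X, G, ⟨hXm.mono hle le_rfl, hX2, ?_, hmart⟩, hG, ?_, ?_⟩
  · obtain ⟨g, hg, hgR⟩ := hXm.exists_eq_measurable_comp
    obtain ⟨φ, hφ, hφR⟩ := hRf.functionOf
    refine ⟨g ∘ φ, hg.comp hφ, hφR.mono fun ω hω => ?_⟩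
    rw [hgR]
    exact congrArg g hω
  · exact Set.eq_univ_of_forall fun r => ⟨f r, hfG' r⟩
  · have hval : ∫ ω, gain (stdMatrix m) (pair (R ω) (f (R ω))) (pair (U ω) (V ω)) ∂P
        = 1 / 2 * ∫ ω, sForm (stdMatrix m) (X ω) (pair (U ω) (V ω)) ∂P := by
      rw [← integral_gain_condExp hle hX₀m.stronglyMeasurable.aestronglyMeasurable hX₀ hY,
        ← integral_sForm_self_eq (hXm.mono hle le_rfl) hX2 hY hmart, ← integral_const_mul]
      refine integral_congr_ae ?_
      filter_upwards [hRf.efficient, sndL_condExp_pair (n := MeasurableSpace.comap R inferInstance)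
        (hY.integrable one_le_two)] with ω h1 h2
      rw [← hX] at h2
      have h3 : X ω = pair (fstL m (X ω)) (f (R ω)) := by
        rw [h1, ← h2, pair_fstL_sndL]
      rw [← hX, ← gain_self, h3, gain_pair, gain_pair, sub_self, inner_zero_right,
        inner_zero_right]
    rw [← hval]
    refine extIntegral_fitzpatrick_le hYm (integrable_gain _ hX₀ hY) ?_
    filter_upwards [hRf.profit_max] with ω hω a ha
    refine gain_le_of_graph_subset hG.prop hfG' (fun r => ?_) ha
    have := hω (r - U ω)
    rw [sub_add_cancel, sub_add_cancel] at this
    rw [gain_pair, gain_pair]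
    linarith

theorem isBackwardMap_pair (hU : MemLp U 2 P) (hV : MemLp V 2 P) (hRm : Measurable R)
    (hR : MemLp R 2 P) (hRY : IsFunctionOf P R fun ω => pair (U ω) (V ω)) (hf : Measurable f)
    (hRU : P[U | MeasurableSpace.comap R inferInstance] =ᵐ[P] R)
    (hfV : P[V | MeasurableSpace.comap R inferInstance] =ᵐ[P] fun ω => f (R ω)) :
    IsBackwardMap P (fun ω => pair (U ω) (V ω)) fun ω => pair (R ω) (f (R ω)) := by
  have hY : MemLp (fun ω => pair (U ω) (V ω)) 2 P := memLp_pair hU hV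
  have hX : MemLp (fun ω => pair (R ω) (f (R ω))) 2 P :=
    memLp_pair hR ((memLp_congr_ae hfV).1 (hV.condExp one_le_two))
  have hXm : Measurable[MeasurableSpace.comap R inferInstance]
      fun ω => pair (R ω) (f (R ω)) :=
    (measurable_pair measurable_id hf).comp (comap_measurable R)
  refine ⟨measurable_pair hRm (hf.comp hRm), hX, ?_,
    condExp_comap_eq_self hRm.comap_le hXm ?_ (hX.integrable one_le_two)⟩
  · obtain ⟨φ, hφ, hφR⟩ := hRY
    exact ⟨fun y => pair (φ y) (f (φ y)), measurable_pair hφ (hf.comp hφ),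
      hφR.mono fun ω hω => by simp only [hω]⟩
  · filter_upwards [hRU, hfV, fstL_condExp_pair (n := MeasurableSpace.comap R inferInstance)
      (hY.integrable one_le_two), sndL_condExp_pair (n := MeasurableSpace.comap R inferInstance)
      (hY.integrable one_le_two)] with ω h1 h2 h3 h4
    rw [← pair_fstL_sndL (P[_ | _] ω), h3, h4, h1, h2]

/-- A primal-dual pair `(X, G)` without duality gap, with `G` projecting onto `ℝ^m`, yields an
equilibrium whose pricing function is a selection of `G`. -/
theorem exists_isEquilibrium_of_no_gap (hU : MemLp U 2 P) (hV : MemLp V 2 P)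
    (hUm : Measurable U) (hVm : Measurable V) {X : Ω → EuclideanSpace ℝ (Fin m ⊕ Fin m)}
    (hX : IsBackwardMap P (fun ω => pair (U ω) (V ω)) X) (hG : IsMaxSMonotone (stdMatrix m) G)
    (hproj : projFst G = Set.univ)
    (hgap : extIntegral (P.map fun ω => pair (U ω) (V ω)) (fitzpatrick (stdMatrix m) G)
        ≤ ((1 / 2 * ∫ ω, sForm (stdMatrix m) (X ω) (pair (U ω) (V ω)) ∂P : ℝ) : EReal)) :
    ∃ R f, IsEquilibrium P U V R f ∧ (∀ r, pair r (f r) ∈ G) ∧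
      IsOptimalMap (stdMatrix m) P (fun ω => pair (U ω) (V ω))
        fun ω => pair (R ω) (f (R ω)) := by
  have hY : MemLp (fun ω => pair (U ω) (V ω)) 2 P := memLp_pair hU hV
  have hYm : Measurable fun ω => pair (U ω) (V ω) := measurable_pair hUm hVm
  have hS : (stdMatrix m).IsSymm := isSymm_stdMatrix
  set R : Ω → EuclideanSpace ℝ (Fin m) := fun ω => fstL m (X ω) with hRdef
  have hRX : Measurable[MeasurableSpace.comap X inferInstance] R :=
    (fstL m).continuous.measurable.comp (comap_measurable X)
  have hRm : Measurable R := hRX.mono hX.measurable.comap_le le_rfl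
  have hR : MemLp R 2 P := (fstL m).comp_memLp' hX.memLp
  have hRY : IsFunctionOf P R fun ω => pair (U ω) (V ω) := by
    obtain ⟨φ, hφ, hφX⟩ := hX.functionOf
    exact ⟨fun y => fstL m (φ y), (fstL m).continuous.measurable.comp hφ,
      hφX.mono fun ω hω => by simp only [hRdef, hω]⟩
  have hUX : P[U | MeasurableSpace.comap X inferInstance] =ᵐ[P] R := by
    filter_upwards [hX.martingale, fstL_condExp_pair (n := MeasurableSpace.comap X inferInstance)
      (hY.integrable one_le_two)] with ω h1 h2
    rw [← h2, h1]
  have hVX : P[V | MeasurableSpace.comap X inferInstance] =ᵐ[P] fun ω => sndL m (X ω) := by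
    filter_upwards [hX.martingale, sndL_condExp_pair (n := MeasurableSpace.comap X inferInstance)
      (hY.integrable one_le_two)] with ω h1 h2
    rw [← h2, h1]
  have hRU : P[U | MeasurableSpace.comap R inferInstance] =ᵐ[P] R :=
    condExp_comap_eq_self hX.measurable.comap_le hRX hUX (hR.integrable one_le_two)
  obtain ⟨g, hgm, hgR⟩ := (stronglyMeasurable_condExp (f := V) (μ := P)
    (m := MeasurableSpace.comap R inferInstance)).measurable.exists_eq_measurable_comp
  have hgV : P[V | MeasurableSpace.comap R inferInstance] =ᵐ[P] fun ω => g (R ω) := by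
    rw [hgR]; rfl
  have hX₁ := isBackwardMap_pair hU hV hRm hR hRY hgm hRU hgV
  have hsform : ∀ x : EuclideanSpace ℝ (Fin m ⊕ Fin m),
      1 / 2 * sForm (stdMatrix m) x x = ⟪fstL m x, sndL m x⟫ := fun x => by
    rw [sForm_stdMatrix, real_inner_comm]; ring
  -- replacing the second component of `X` by `E[V | R]` does not change the value
  have hval : 1 / 2 * ∫ ω, sForm (stdMatrix m) (pair (R ω) (g (R ω))) (pair (U ω) (V ω)) ∂P
      = 1 / 2 * ∫ ω, sForm (stdMatrix m) (X ω) (pair (U ω) (V ω)) ∂P := by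
    rw [← integral_sForm_self_eq hX₁.measurable hX₁.memLp hY hX₁.martingale,
      ← integral_sForm_self_eq hX.measurable hX.memLp hY hX.martingale, ← integral_const_mul,
      ← integral_const_mul]
    simp only [hsform, fstL_pair, sndL_pair]
    have h1 := integral_inner_condExp hRm.comap_le
      (comap_measurable R).stronglyMeasurable.aestronglyMeasurable hR hV
    have h2 := integral_inner_condExp hX.measurable.comap_le
      hRX.stronglyMeasurable.aestronglyMeasurable hR hV
    have h3 : ∫ ω, ⟪R ω, P[V | MeasurableSpace.comap R inferInstance] ω⟫ ∂P
        = ∫ ω, ⟪R ω, g (R ω)⟫ ∂P :=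
      integral_congr_ae (hgV.mono fun ω hω => by simp only [hω])
    have h4 : ∫ ω, ⟪R ω, P[V | MeasurableSpace.comap X inferInstance] ω⟫ ∂P
        = ∫ ω, ⟪R ω, sndL m (X ω)⟫ ∂P :=
      integral_congr_ae (hVX.mono fun ω hω => by simp only [hω])
    exact h3.symm.trans (h1.trans (h2.symm.trans h4))
  have hslack := ae_mem_and_gain_le_gain hS hG hX₁.measurable hX₁.memLp hYm hY hX₁.martingale
    (by rw [hval]; exact hgap)
  obtain ⟨s, hsm, hsG⟩ := hG.exists_measurable_selection hproj
  classical
  set f : EuclideanSpace ℝ (Fin m) → EuclideanSpace ℝ (Fin m) :=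
    fun r => if pair r (g r) ∈ G then g r else s r with hfdef
  have hfm : Measurable f := Measurable.ite
    (measurable_pair measurable_id hgm (hG.isClosed hS).measurableSet) hgm hsm
  have hfG : ∀ r, pair r (f r) ∈ G := fun r => by
    by_cases h : pair r (g r) ∈ G <;> simp only [hfdef, h, if_true, if_false, hsG]
  have hfg : ∀ᵐ ω ∂P, f (R ω) = g (R ω) := hslack.mono fun ω hω => if_pos hω.1
  have hfV : P[V | MeasurableSpace.comap R inferInstance] =ᵐ[P] fun ω => f (R ω) :=
    hgV.trans (hfg.mono fun ω hω => hω.symm)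
  have hX₂ := isBackwardMap_pair hU hV hRm hR hRY hfm hRU hfV
  refine ⟨R, f, ⟨hRm, hR, hfm, hRY, hfV.symm, ?_⟩, hfG,
    (optimal_of_no_gap hS hG hYm hY hX₂ ?_).1⟩
  · filter_upwards [hslack, hfg] with ω hω hω' q
    have h := hω.2 _ (hfG (q + U ω))
    rw [← hω', gain_pair, gain_pair, add_sub_cancel_right] at h
    rw [sub_add_cancel]
    linarith
  · have h : ∫ ω, sForm (stdMatrix m) (pair (R ω) (f (R ω))) (pair (U ω) (V ω)) ∂P
        = ∫ ω, sForm (stdMatrix m) (pair (R ω) (g (R ω))) (pair (U ω) (V ω)) ∂P :=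
      integral_congr_ae (hfg.mono fun ω hω => by simp only [hω])
    rw [h, hval]
    exact hgap

end Equilibrium

end BackwardTransport


open BackwardTransport
theorem theorem8 {Ω : Type*} [MeasurableSpace Ω] (P : Measure Ω) [IsProbabilityMeasure P]
    (m : ℕ) (U V : Ω → EuclideanSpace ℝ (Fin m))
    (hU : Measurable U) (hV : Measurable V) (hU2 : MemLp U 2 P) (hV2 : MemLp V 2 P)
    (Y : Ω → EuclideanSpace ℝ (Fin m ⊕ Fin m)) (hY : Y = fun ω => pair (U ω) (V ω))
    (ν : Measure (EuclideanSpace ℝ (Fin m ⊕ Fin m))) (hν : ν = P.map Y) :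
    ((∃ R f, IsEquilibrium P U V R f ∧ IsMonotoneMap f) ↔
      ∃ X G, IsOptimalMap (stdMatrix m) P Y X ∧ IsDualOptimal (stdMatrix m) ν G ∧
        IsOptimalPlan (stdMatrix m) ν (P.map fun ω => (X ω, Y ω)) ∧
        projFst G = Set.univ) ∧
    ((∃ R f, IsEquilibrium P U V R f ∧ IsMonotoneMap f) →
      ∀ G, IsDualOptimal (stdMatrix m) ν G → projFst G = Set.univ →
        ∃ R f, IsEquilibrium P U V R f ∧ (∀ r, pair r (f r) ∈ G) ∧
          IsOptimalMap (stdMatrix m) P Y fun ω => pair (R ω) (f (R ω))) := by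
  subst hY
  subst hν
  have hY2 : MemLp (fun ω => pair (U ω) (V ω)) 2 P := memLp_pair hU2 hV2
  have hYm : Measurable fun ω => pair (U ω) (V ω) := measurable_pair hU hV
  refine ⟨⟨?_, ?_⟩, ?_⟩
  · rintro ⟨R, f, hRf, hf⟩
    obtain ⟨X, G, hX, hG, hproj, hgap⟩ := hRf.exists_no_gap hU2 hV2 hU hV hf
    obtain ⟨h1, h2, h3⟩ := optimal_of_no_gap isSymm_stdMatrix hG hYm hY2 hX hgap
    exact ⟨X, G, h1, h2, h3, hproj⟩
  · rintro ⟨X, G, hX, hG, hplan, hproj⟩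
    obtain ⟨H, hH, hHgap⟩ := exists_isMaxSMonotone_of_isOptimalPlan hplan
    have hgap := (hG.2 H hH).trans hHgap
    rw [integral_map (hX.1.measurable.prodMk hYm).aemeasurable
      (Continuous.aestronglyMeasurable (by fun_prop))] at hgap
    obtain ⟨R, f, hRf, hfG, -⟩ :=
      exists_isEquilibrium_of_no_gap hU2 hV2 hU hV hX.1 hG.1 hproj hgap
    refine ⟨R, f, hRf, fun u r => ?_⟩
    have h := hG.1.prop _ (hfG u) _ (hfG r)
    rw [sForm_stdMatrix] at h
    simp only [map_sub, fstL_pair, sndL_pair] at h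
    rw [real_inner_comm] at h
    linarith
  · rintro ⟨R, f, hRf, hf⟩ G hG hproj
    obtain ⟨X, H, hX, hH, -, hgap⟩ := hRf.exists_no_gap hU2 hV2 hU hV hf
    exact exists_isEquilibrium_of_no_gap hU2 hV2 hU hV hX hG.1 hproj ((hG.2 H hH).trans hgap)
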